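/- Let $\mathbb N=\{1,2,3,\dots\}$. Let $s$ be the Fréchet space of complex sequences $\xi=(\xi_j)_{j\ge1}$ with $|\xi|_n:=\big(\sum_{j}|\xi_j|^2j^{2n}\big)^{1/2}<\infty$ for all $n$, topologized by the norms $|\cdot|_n$, and let $s'$ be its dual, i.e. the space of sequences $\eta$ with $|\eta|'_n:=\big(\sum_j|\eta_j|^2j^{-2n}\big)^{1/2}<\infty$ for some $n$, with the strong dual topology given by the pairing $\langle\xi,\eta\rangle=\sum_j\xi_j\overline{\eta_j}$; put $U_n^\circ=\{\eta\in s':|\eta|'_n\le1\}$. The noncommutative Schwartz space $\mathcal S=L(s',s)$ is the space of continuous linear maps $s'\to s$ with the topology of uniform convergence on bounded sets, the product $xy=x\circ\iota\circ y$, where $\iota:s\hookrightarrow s'$ is the formal identity, and the involution given by $\langle x^*\xi,\eta\rangle=\langle\xi,x\eta\rangle$ for $\xi,\eta\in s'$. Put $$\|x\|_n=\sup\{|x\xi|_n:\xi\in U_n^\circ\}\qquad(x\in\mathcal S),$$ for a continuous bilinear form $u:\mathcal S\times\mathcal S\to\mathbb C$ put $\|u\|_n^*=\sup\{|u(x,y)|:\|x\|_n\le1,\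 \|y\|_n\le1\}\in[0,\infty]$, and for $x_1,\dots,x_m\in\mathcal S$ put $$\|(x_j)\|_k^{RC}=\max\Big\{\Big\|\sum_jx_j^*x_j\Big\|_k^{1/2},\Big\|\sum_jx_jx_j^*\Big\|_k^{1/2}\Big\}.$$ For $n\in\mathbb N$ let $K_n\in[0,\infty]$ be the best (smallest) constant such that $$\Big|\sum_{j=1}^mu(x_j,y_j)\Big|\le K_n\,\|u\|_n^*\,\|(x_j)\|_{2n+1}^{RC}\,\|(y_j)\|_{2n+1}^{RC}$$ for all continuous bilinear forms $u:\mathcal S\times\mathcal S\to\mathbb C$, all $m$ and all $x_1,\dots,x_m,y_1,\dots,y_m\in\mathcal S$, and let $K=\sup_{n\in\mathbb N}K_n$. An $n$-state on $\mathcal S$ is an element of the weak* closed convex hull in $\mathcal S'$ of the vector functionals $\phi_\xi(x)=\langle x\xi,\xi\rangle$, $\xi\in U_n^\circ$. Theorem. One has $K\le\pi^2/6$, and for every continuous bilinear form $u:\mathcal S\times\mathcal S\to\mathbb C$ and every $n\in\mathbb N$ there are $(2n+1)$-states $\phi_1,\phi_2,\psi_1,\psi_2$ on $\mathcal S$ such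 that $$|u(x,y)|\le K\,\|u\|_n^*\,\big(\phi_1(x^*x)+\phi_2(xx^*)\big)^{1/2}\big(\psi_1(y^*y)+\psi_2(yy^*)\big)^{1/2}\qquad\text{for all }x,y\in\mathcal S,$$ where both sides are read in $[0,\infty]$ with $0\cdot\infty=0$. -/

import Mathlib

open scoped ENNReal ComplexConjugate

noncomputable section

namespace NCSchwartz

/-! ### Weighted `ℓ²` norms of sequences indexed by `{1, 2, 3, …}` -/

/-- `∑ⱼ |ξⱼ|² j²ᵏ < ∞`, for an integer `k`. -/
def WSummable (k : ℤ) (ξ : ℕ+ → ℂ) : Prop :=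
  Summable fun j : ℕ+ => ‖ξ j‖ ^ 2 * (j : ℝ) ^ (2 * k)

/-- `(∑ⱼ |ξⱼ|² j²ᵏ)^{1/2}` (meaningful if `WSummable k ξ`). For `k = n` this is the norm `|ξ|_n`,
for `k = -n` it is the dual norm `|ξ|'_n`. -/
def wNorm (k : ℤ) (ξ : ℕ+ → ℂ) : ℝ :=
  √(∑' j : ℕ+, ‖ξ j‖ ^ 2 * (j : ℝ) ^ (2 * k))

/-- The duality pairing `⟨ξ, η⟩ = ∑ⱼ ξⱼ conj(ηⱼ)`. -/
def pairing (ξ η : ℕ+ → ℂ) : ℂ := ∑' j : ℕ+, ξ j * conj (η j)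

theorem pos_cast (j : ℕ+) : (0 : ℝ) < (j : ℝ) := by exact_mod_cast j.pos

theorem term_eq (k : ℤ) (ξ : ℕ+ → ℂ) (j : ℕ+) :
    ‖ξ j‖ ^ 2 * (j : ℝ) ^ (2 * k) = (‖ξ j‖ * (j : ℝ) ^ k) ^ 2 := by
  rw [mul_pow, mul_comm (2 : ℤ) k, zpow_mul]
  norm_cast

theorem term_nonneg (k : ℤ) (ξ : ℕ+ → ℂ) (j : ℕ+) : 0 ≤ ‖ξ j‖ ^ 2 * (j : ℝ) ^ (2 * k) := by
  rw [term_eq]; positivity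

theorem aux_nonneg (k : ℤ) (ξ : ℕ+ → ℂ) (j : ℕ+) : 0 ≤ ‖ξ j‖ * (j : ℝ) ^ k :=
  mul_nonneg (norm_nonneg _) (zpow_nonneg (pos_cast j).le _)

theorem WSummable.zero (k : ℤ) : WSummable k 0 := by
  simp [WSummable, summable_zero]

theorem WSummable.add {k : ℤ} {ξ η : ℕ+ → ℂ} (hξ : WSummable k ξ) (hη : WSummable k η) :
    WSummable k (ξ + η) := by
  refine Summable.of_nonneg_of_le (term_nonneg k _) (fun j => ?_) ((Summable.add hξ hη).mul_left 2)
  have hw : (0 : ℝ) ≤ (j : ℝ) ^ (2 * k) := zpow_nonneg (pos_cast j).le _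
  have h1 : ‖(ξ + η) j‖ ^ 2 ≤ 2 * (‖ξ j‖ ^ 2 + ‖η j‖ ^ 2) := by
    have := norm_add_le (ξ j) (η j)
    have h0 := norm_nonneg (ξ j + η j)
    simp only [Pi.add_apply]
    nlinarith [sq_nonneg (‖ξ j‖ - ‖η j‖)]
  calc _ ≤ 2 * (‖ξ j‖ ^ 2 + ‖η j‖ ^ 2) * (j : ℝ) ^ (2 * k) := by gcongr
    _ = _ := by ring

theorem WSummable.smul {k : ℤ} (c : ℂ) {ξ : ℕ+ → ℂ} (hξ : WSummable k ξ) :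
    WSummable k (c • ξ) := by
  refine (hξ.mul_left (‖c‖ ^ 2)).congr fun j => ?_
  simp [mul_pow, mul_assoc]

theorem WSummable.mono {k l : ℤ} (hkl : k ≤ l) {ξ : ℕ+ → ℂ} (hξ : WSummable l ξ) :
    WSummable k ξ := by
  refine Summable.of_nonneg_of_le (term_nonneg k _) (fun j => ?_) hξ
  have : (1 : ℝ) ≤ j := by exact_mod_cast Nat.succ_le_of_lt j.pos
  gcongr

theorem wNorm_nonneg (k : ℤ) (ξ : ℕ+ → ℂ) : 0 ≤ wNorm k ξ := Real.sqrt_nonneg _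

theorem wNorm_sq (k : ℤ) (ξ : ℕ+ → ℂ) :
    wNorm k ξ ^ 2 = ∑' j : ℕ+, ‖ξ j‖ ^ 2 * (j : ℝ) ^ (2 * k) :=
  Real.sq_sqrt (tsum_nonneg (term_nonneg k ξ))

theorem wNorm_zero (k : ℤ) : wNorm k 0 = 0 := by simp [wNorm]

theorem wNorm_smul (k : ℤ) (c : ℂ) (ξ : ℕ+ → ℂ) : wNorm k (c • ξ) = ‖c‖ * wNorm k ξ := by
  have : ∀ j : ℕ+, ‖(c • ξ) j‖ ^ 2 * (j : ℝ) ^ (2 * k)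
      = ‖c‖ ^ 2 * (‖ξ j‖ ^ 2 * (j : ℝ) ^ (2 * k)) := by
    intro j; simp [mul_pow, mul_assoc]
  simp only [wNorm, this, tsum_mul_left]
  rw [Real.sqrt_mul (by positivity), Real.sqrt_sq (norm_nonneg _)]

theorem wNorm_coord_le {k : ℤ} {ξ : ℕ+ → ℂ} (hξ : WSummable k ξ) (j : ℕ+) :
    ‖ξ j‖ * (j : ℝ) ^ k ≤ wNorm k ξ := by
  apply Real.le_sqrt_of_sq_le
  rw [← term_eq]
  exact hξ.le_tsum j fun i _ => term_nonneg k ξ i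

theorem wNorm_add_le {k : ℤ} {ξ η : ℕ+ → ℂ} (hξ : WSummable k ξ) (hη : WSummable k η) :
    wNorm k (ξ + η) ≤ wNorm k ξ + wNorm k η := by
  have hf : Summable fun j : ℕ+ => (‖ξ j‖ * (j : ℝ) ^ k) ^ (2 : ℝ) := by
    simpa only [WSummable, term_eq, Real.rpow_two] using hξ
  have hg : Summable fun j : ℕ+ => (‖η j‖ * (j : ℝ) ^ k) ^ (2 : ℝ) := by
    simpa only [WSummable, term_eq, Real.rpow_two] using hη
  have h := Real.Lp_add_le_tsum_of_nonneg (p := 2) one_le_two (aux_nonneg k ξ)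
    (aux_nonneg k η) hf hg
  have h2 := h.2
  have h1 := h.1
  simp only [← Real.sqrt_eq_rpow, Real.rpow_two] at h1 h2
  have h3 : wNorm k (ξ + η) ≤
      √(∑' j : ℕ+, (‖ξ j‖ * (j : ℝ) ^ k + ‖η j‖ * (j : ℝ) ^ k) ^ 2) := by
    apply Real.sqrt_le_sqrt
    refine Summable.tsum_le_tsum (fun j => ?_) (hξ.add hη) h1
    rw [term_eq, ← add_mul]
    have hw : (0 : ℝ) ≤ (j : ℝ) ^ k := zpow_nonneg (pos_cast j).le _
    gcongr
    exact norm_add_le _ _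
  refine h3.trans (h2.trans_eq ?_)
  simp only [wNorm, term_eq]

theorem pairing_term (k : ℤ) (ξ η : ℕ+ → ℂ) (j : ℕ+) :
    ‖ξ j * conj (η j)‖ = (‖ξ j‖ * (j : ℝ) ^ k) * (‖η j‖ * (j : ℝ) ^ (-k)) := by
  have : (j : ℝ) ^ k * (j : ℝ) ^ (-k) = 1 := by
    rw [← zpow_add₀ (pos_cast j).ne']; simp
  rw [norm_mul, RCLike.norm_conj]
  linear_combination (-‖ξ j‖ * ‖η j‖) * this

theorem pairing_summable_and_le {k : ℤ} {ξ η : ℕ+ → ℂ} (hξ : WSummable k ξ)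
    (hη : WSummable (-k) η) :
    (Summable fun j => ‖ξ j * conj (η j)‖) ∧
      ∑' j, ‖ξ j * conj (η j)‖ ≤ wNorm k ξ * wNorm (-k) η := by
  have hf : Summable fun j : ℕ+ => (‖ξ j‖ * (j : ℝ) ^ k) ^ (2 : ℝ) := by
    simpa only [WSummable, term_eq, Real.rpow_two] using hξ
  have hg : Summable fun j : ℕ+ => (‖η j‖ * (j : ℝ) ^ (-k)) ^ (2 : ℝ) := by
    simpa only [WSummable, term_eq, Real.rpow_two] using hη
  have h := Real.summable_and_inner_le_Lp_mul_Lq_tsum_of_nonneg Real.HolderConjugate.two_two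
    (aux_nonneg k ξ) (aux_nonneg (-k) η) hf hg
  simp only [← Real.sqrt_eq_rpow, Real.rpow_two] at h
  simp only [pairing_term k, wNorm, term_eq]
  exact h

theorem pairing_summable {k : ℤ} {ξ η : ℕ+ → ℂ} (hξ : WSummable k ξ) (hη : WSummable (-k) η) :
    Summable fun j => ξ j * conj (η j) :=
  (pairing_summable_and_le hξ hη).1.of_norm

theorem norm_pairing_le {k : ℤ} {ξ η : ℕ+ → ℂ} (hξ : WSummable k ξ) (hη : WSummable (-k) η) :
    ‖pairing ξ η‖ ≤ wNorm k ξ * wNorm (-k) η :=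
  (norm_tsum_le_tsum_norm (pairing_summable_and_le hξ hη).1).trans
    (pairing_summable_and_le hξ hη).2

theorem pairing_conj (ξ η : ℕ+ → ℂ) : conj (pairing ξ η) = pairing η ξ := by
  simp only [pairing, Complex.conj_tsum, map_mul, Complex.conj_conj]
  exact tsum_congr fun j => mul_comm _ _

theorem pairing_smul_left (c : ℂ) (ξ η : ℕ+ → ℂ) : pairing (c • ξ) η = c * pairing ξ η := by
  simp only [pairing, Pi.smul_apply, smul_eq_mul, mul_assoc, tsum_mul_left]

/-! ### The space `s` of rapidly decreasing sequences -/

/-- Sequences with `|ξ|_n < ∞` for all `n`. -/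
def rapidSubmodule : Submodule ℂ (ℕ+ → ℂ) where
  carrier := {ξ | ∀ n : ℕ, WSummable n ξ}
  add_mem' ha hb n := (ha n).add (hb n)
  zero_mem' n := WSummable.zero n
  smul_mem' c _ h n := (h n).smul c

/-- The space `s`. -/
def Rapid : Type := rapidSubmodule

instance : AddCommGroup Rapid := inferInstanceAs (AddCommGroup rapidSubmodule)
instance : Module ℂ Rapid := inferInstanceAs (Module ℂ rapidSubmodule)

/-- The underlying sequence. -/
def Rapid.seq (ξ : Rapid) : ℕ+ → ℂ := Subtype.val ξ

theorem Rapid.wsummable (ξ : Rapid) (n : ℕ) : WSummable n ξ.seq := Subtype.property ξ n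

theorem Rapid.seq_add (ξ η : Rapid) : (ξ + η).seq = ξ.seq + η.seq := rfl
theorem Rapid.seq_smul (c : ℂ) (ξ : Rapid) : (c • ξ).seq = c • ξ.seq := rfl
theorem Rapid.seq_zero : (0 : Rapid).seq = 0 := rfl

/-- The norm `|·|_n` on `s`. -/
def rapidNorm (n : ℕ) : Seminorm ℂ Rapid :=
  Seminorm.of (fun ξ => wNorm n ξ.seq)
    (fun ξ η => wNorm_add_le (ξ.wsummable n) (η.wsummable n))
    (fun c ξ => wNorm_smul n c ξ.seq)

/-- The topology of `s` is given by the norms `|·|_n`. -/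
instance : TopologicalSpace Rapid :=
  (SeminormFamily.moduleFilterBasis rapidNorm).topology

theorem rapid_withSeminorms : WithSeminorms (𝕜 := ℂ) (E := Rapid) rapidNorm := ⟨rfl⟩

instance : IsTopologicalAddGroup Rapid := rapid_withSeminorms.topologicalAddGroup
instance : ContinuousSMul ℂ Rapid := rapid_withSeminorms.continuousSMul

/-! ### The dual space `s'` of slowly increasing sequences -/

/-- Sequences with `|η|'_n < ∞` for some `n`. -/
def slowSubmodule : Submodule ℂ (ℕ+ → ℂ) where
  carrier := {η | ∃ n : ℕ, WSummable (-n) η}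
  add_mem' := by
    rintro a b ⟨n, hn⟩ ⟨m, hm⟩
    exact ⟨max n m, (hn.mono (by simp)).add (hm.mono (by simp))⟩
  zero_mem' := ⟨0, WSummable.zero _⟩
  smul_mem' := by
    rintro c a ⟨n, hn⟩
    exact ⟨n, hn.smul c⟩

/-- The space `s'`. -/
def Slow : Type := slowSubmodule

instance : AddCommGroup Slow := inferInstanceAs (AddCommGroup slowSubmodule)
instance : Module ℂ Slow := inferInstanceAs (Module ℂ slowSubmodule)

/-- The underlying sequence. -/
def Slow.seq (η : Slow) : ℕ+ → ℂ := Subtype.val η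

theorem Slow.wsummable (η : Slow) : ∃ n : ℕ, WSummable (-n) η.seq := Subtype.property η

theorem Slow.seq_add (ξ η : Slow) : (ξ + η).seq = ξ.seq + η.seq := rfl
theorem Slow.seq_smul (c : ℂ) (ξ : Slow) : (c • ξ).seq = c • ξ.seq := rfl
theorem Slow.seq_zero : (0 : Slow).seq = 0 := rfl

theorem pairing_add_right (ξ : Rapid) (η ζ : Slow) :
    pairing ξ.seq (η + ζ).seq = pairing ξ.seq η.seq + pairing ξ.seq ζ.seq := by
  obtain ⟨n, hn⟩ := η.wsummable
  obtain ⟨m, hm⟩ := ζ.wsummable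
  simp only [pairing, Slow.seq_add, Pi.add_apply, map_add, mul_add]
  exact (pairing_summable (ξ.wsummable n) hn).tsum_add (pairing_summable (ξ.wsummable m) hm)

theorem pairing_add_left (ξ ζ : Rapid) (η : Slow) :
    pairing (ξ + ζ).seq η.seq = pairing ξ.seq η.seq + pairing ζ.seq η.seq := by
  obtain ⟨n, hn⟩ := η.wsummable
  simp only [pairing, Rapid.seq_add, Pi.add_apply, add_mul]
  exact (pairing_summable (ξ.wsummable n) hn).tsum_add (pairing_summable (ζ.wsummable n) hn)

theorem norm_pairing_smul_right (c : ℂ) (ξ : Rapid) (η : Slow) :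
    ‖pairing ξ.seq (c • η).seq‖ = ‖c‖ * ‖pairing ξ.seq η.seq‖ := by
  rw [← pairing_conj, Slow.seq_smul, pairing_smul_left, map_mul, norm_mul, pairing_conj,
    RCLike.norm_conj]

/-- The bounded subsets of `s`. -/
abbrev BddRapid : Type := {B : Set Rapid // Bornology.IsVonNBounded ℂ B}

instance : Nonempty BddRapid := ⟨⟨∅, Bornology.isVonNBounded_empty ℂ Rapid⟩⟩

theorem bddRapid_bound {B : Set Rapid} (hB : Bornology.IsVonNBounded ℂ B) (n : ℕ) :
    ∃ C > 0, ∀ ξ ∈ B, wNorm n ξ.seq ≤ C := by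
  obtain ⟨r, hr, h⟩ := rapid_withSeminorms.isVonNBounded_iff_seminorm_bounded.1 hB n
  exact ⟨r, hr, fun ξ hξ => (h ξ hξ).le⟩

theorem bddAbove_pairing (B : BddRapid) (η : Slow) :
    BddAbove (Set.range fun ξ : B.1 => ‖pairing ξ.1.seq η.seq‖) := by
  obtain ⟨n, hn⟩ := η.wsummable
  obtain ⟨C, hC, h⟩ := bddRapid_bound B.2 n
  refine ⟨C * wNorm (-n) η.seq, ?_⟩
  rintro _ ⟨ξ, rfl⟩
  refine (norm_pairing_le (ξ.1.wsummable n) hn).trans ?_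
  exact mul_le_mul_of_nonneg_right (h ξ.1 ξ.2) (wNorm_nonneg _ _)

/-- The seminorm `η ↦ sup_{ξ ∈ B} |⟨ξ, η⟩|` on `s'`, for a bounded set `B` in `s`. -/
def slowSeminorm (B : BddRapid) : Seminorm ℂ Slow :=
  Seminorm.of (fun η => ⨆ ξ : B.1, ‖pairing ξ.1.seq η.seq‖)
    (fun η ζ => by
      refine Real.iSup_le (fun ξ => ?_) (add_nonneg (Real.iSup_nonneg fun _ => norm_nonneg _)
        (Real.iSup_nonneg fun _ => norm_nonneg _))
      rw [pairing_add_right]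
      exact (norm_add_le _ _).trans (add_le_add (le_ciSup (bddAbove_pairing B η) ξ)
        (le_ciSup (bddAbove_pairing B ζ) ξ)))
    (fun c η => by
      simp only [norm_pairing_smul_right]
      exact (Real.mul_iSup_of_nonneg (norm_nonneg c) _).symm)

/-- `s'` carries the strong dual topology: uniform convergence on the bounded subsets of `s`. -/
instance : TopologicalSpace Slow :=
  (SeminormFamily.moduleFilterBasis slowSeminorm).topology

theorem slow_withSeminorms : WithSeminorms (𝕜 := ℂ) (E := Slow) slowSeminorm := ⟨rfl⟩

instance : IsTopologicalAddGroup Slow := slow_withSeminorms.topologicalAddGroup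
instance : ContinuousSMul ℂ Slow := slow_withSeminorms.continuousSMul

theorem norm_pairing_le_slowSeminorm (B : BddRapid) {ξ : Rapid} (hξ : ξ ∈ B.1) (η : Slow) :
    ‖pairing ξ.seq η.seq‖ ≤ slowSeminorm B η :=
  le_ciSup (bddAbove_pairing B η) ⟨ξ, hξ⟩

theorem slowSeminorm_le (B : BddRapid) (η : Slow) {C : ℝ} (hC : 0 ≤ C)
    (h : ∀ ξ ∈ B.1, ‖pairing ξ.seq η.seq‖ ≤ C) : slowSeminorm B η ≤ C :=
  Real.iSup_le (fun ξ => h ξ.1 ξ.2) hC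

/-- The polar `U_n° = {η ∈ s' : |η|'_n ≤ 1}`. -/
def polarBall (n : ℕ) : Set Slow := {η | WSummable (-n) η.seq ∧ wNorm (-n) η.seq ≤ 1}

/-- The formal identity map `s → s'`, as a linear map. -/
def inclLin : Rapid →ₗ[ℂ] Slow where
  toFun ξ := (⟨ξ.seq, 0, by simpa using ξ.wsummable 0⟩ : slowSubmodule)
  map_add' _ _ := rfl
  map_smul' _ _ := rfl

/-- The formal identity map `ι : s → s'`. -/
def incl : Rapid →L[ℂ] Slow :=
  { inclLin with
    cont := by
      refine WithSeminorms.continuous_of_isBounded rapid_withSeminorms slow_withSeminorms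
        inclLin fun B => ?_
      obtain ⟨C, hC, h⟩ := bddRapid_bound B.2 0
      refine ⟨{0}, ⟨C, hC.le⟩, fun ξ => ?_⟩
      rw [Finset.sup_singleton]
      refine slowSeminorm_le B _ (mul_nonneg hC.le (wNorm_nonneg _ _)) fun b hb => ?_
      have h0 := norm_pairing_le (k := 0) (b.wsummable 0) (by simpa using ξ.wsummable 0)
      have h1 := mul_le_mul_of_nonneg_right (h b hb) (wNorm_nonneg 0 ξ.seq)
      rw [neg_zero] at h0
      exact h0.trans h1 }

theorem incl_seq (ξ : Rapid) : (incl ξ).seq = ξ.seq := rfl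

/-! ### The noncommutative Schwartz space -/

/-- The noncommutative Schwartz space `𝒮 = L(s', s)`. As a type of continuous linear maps it
carries the topology of uniform convergence on bounded sets. -/
abbrev Schw : Type := Slow →L[ℂ] Rapid

/-- The product `x y = x ∘ ι ∘ y`. -/
instance : Mul Schw := ⟨fun x y => x.comp (incl.comp y)⟩

theorem mul_apply (x y : Schw) (ξ : Slow) : (x * y) ξ = x (incl (y ξ)) := rfl

/-- The standard unit vector `e_j`, as an element of `s'`. -/
def unitVec (j : ℕ+) : Slow :=
  (⟨Pi.single j 1, 0, summable_of_ne_finset_zero (s := {j}) fun i hi => by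
    have : i ≠ j := by simpa using hi
    simp [this]⟩ : slowSubmodule)

theorem unitVec_seq (j : ℕ+) : (unitVec j).seq = Pi.single j 1 := rfl

theorem pairing_unitVec (ξ : ℕ+ → ℂ) (j : ℕ+) : pairing ξ (unitVec j).seq = ξ j := by
  rw [pairing, tsum_eq_single j]
  · simp [unitVec_seq]
  · intro i hi
    simp [unitVec_seq, hi]

/-- The vectors `jᵐ e_j` form a bounded set in `s'`, hence so do their images in `s`. -/
theorem bounded_columns (x : Schw) (m : ℕ) :
    Bornology.IsVonNBounded ℂ (Set.range fun j : ℕ+ => ((j : ℂ) ^ m) • x (unitVec j)) := by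
  have h : Bornology.IsVonNBounded ℂ (Set.range fun j : ℕ+ => ((j : ℂ) ^ m) • unitVec j) := by
    rw [slow_withSeminorms.isVonNBounded_iff_seminorm_bounded]
    intro B
    obtain ⟨C, hC, h⟩ := bddRapid_bound B.2 m
    refine ⟨C + 1, by linarith, ?_⟩
    rintro _ ⟨j, rfl⟩
    refine lt_of_le_of_lt ?_ (lt_add_one C)
    refine slowSeminorm_le B _ hC.le fun ξ hξ => ?_
    rw [norm_pairing_smul_right, pairing_unitVec]
    have := (wNorm_coord_le (ξ.wsummable m) j).trans (h ξ hξ)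
    simpa [mul_comm] using this
  have := h.image x
  rw [← Set.range_comp] at this
  have h2 : (fun j : ℕ+ => ((j : ℂ) ^ m) • x (unitVec j)) =
      x ∘ fun j : ℕ+ => ((j : ℂ) ^ m) • unitVec j := by
    funext j
    simp
  rwa [h2]

/-- The sequence of `x* ξ`: its `i`-th entry is `⟨ξ, x e_i⟩`. -/
def adjSeq (x : Schw) (ξ : Slow) : ℕ+ → ℂ := fun i => pairing ξ.seq (x (unitVec i)).seq

theorem summable_inv_sq : Summable fun j : ℕ+ => ((j : ℝ) ^ 2)⁻¹ :=
  (Real.summable_nat_pow_inv.2 one_lt_two).comp_injective PNat.coe_injective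

theorem adjSeq_term_le (x : Schw) (n : ℕ) (ξ : Slow) (i : ℕ+) :
    ‖adjSeq x ξ i‖ ^ 2 * (i : ℝ) ^ (2 * (n : ℤ)) ≤
      slowSeminorm ⟨_, bounded_columns x (n + 1)⟩ ξ ^ 2 * ((i : ℝ) ^ 2)⁻¹ := by
  have h := norm_pairing_le_slowSeminorm ⟨_, bounded_columns x (n + 1)⟩
    (Set.mem_range_self i) ξ
  rw [Rapid.seq_smul, pairing_smul_left, norm_mul, ← pairing_conj, RCLike.norm_conj] at h
  have h1 : ‖adjSeq x ξ i‖ * (i : ℝ) ^ (n + 1) ≤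
      slowSeminorm ⟨_, bounded_columns x (n + 1)⟩ ξ := by
    simpa [adjSeq, mul_comm] using h
  have h2 : ‖adjSeq x ξ i‖ ^ 2 * (i : ℝ) ^ (2 * (n : ℤ))
      = (‖adjSeq x ξ i‖ * (i : ℝ) ^ (n + 1)) ^ 2 * ((i : ℝ) ^ 2)⁻¹ := by
    rw [term_eq, zpow_natCast]
    have := (pos_cast i).ne'
    field_simp
    ring
  rw [h2]
  gcongr

theorem adjSeq_wsummable (x : Schw) (ξ : Slow) (n : ℕ) : WSummable n (adjSeq x ξ) :=
  Summable.of_nonneg_of_le (term_nonneg n _) (adjSeq_term_le x n ξ)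
    (summable_inv_sq.mul_left _)

theorem adjSeq_add (x : Schw) (ξ η : Slow) : adjSeq x (ξ + η) = adjSeq x ξ + adjSeq x η := by
  ext i
  simp only [adjSeq, Pi.add_apply]
  rw [← pairing_conj, pairing_add_right, map_add, pairing_conj, pairing_conj]

/-- The adjoint `x*` as a linear map. -/
def adjLin (x : Schw) : Slow →ₗ[ℂ] Rapid where
  toFun ξ := (⟨adjSeq x ξ, adjSeq_wsummable x ξ⟩ : rapidSubmodule)
  map_add' ξ η := Subtype.ext (adjSeq_add x ξ η)
  map_smul' c ξ := Subtype.ext (funext fun _ => pairing_smul_left c ξ.seq _)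

theorem adjLin_seq (x : Schw) (ξ : Slow) : (adjLin x ξ).seq = adjSeq x ξ := rfl

/-- The involution of `𝒮`; its defining property is `star_spec` below. -/
instance : Star Schw := ⟨fun x =>
  { adjLin x with
    cont := by
      refine WithSeminorms.continuous_of_isBounded slow_withSeminorms rapid_withSeminorms
        (adjLin x) fun n => ?_
      refine ⟨{⟨_, bounded_columns x (n + 1)⟩},
        ⟨√(∑' j : ℕ+, ((j : ℝ) ^ 2)⁻¹), Real.sqrt_nonneg _⟩, fun ξ => ?_⟩
      rw [Finset.sup_singleton]
      have h : wNorm n (adjSeq x ξ) ≤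
          √(∑' j : ℕ+, slowSeminorm ⟨_, bounded_columns x (n + 1)⟩ ξ ^ 2 * ((j : ℝ) ^ 2)⁻¹) :=
        Real.sqrt_le_sqrt (Summable.tsum_le_tsum (adjSeq_term_le x n ξ)
          (adjSeq_wsummable x ξ n) (summable_inv_sq.mul_left _))
      rw [tsum_mul_left, Real.sqrt_mul (by positivity), Real.sqrt_sq (apply_nonneg _ _),
        mul_comm] at h
      exact h }⟩

theorem star_seq (x : Schw) (ξ : Slow) (i : ℕ+) :
    (star x ξ).seq i = pairing ξ.seq (x (unitVec i)).seq := rfl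

theorem continuous_pairing (η : Slow) : Continuous fun ξ : Rapid => pairing ξ.seq η.seq := by
  obtain ⟨n, hn⟩ := η.wsummable
  let f : Rapid →ₗ[ℂ] ℂ :=
    { toFun := fun ξ => pairing ξ.seq η.seq
      map_add' := fun ξ ζ => pairing_add_left ξ ζ η
      map_smul' := fun c ξ => pairing_smul_left c ξ.seq η.seq }
  refine WithSeminorms.continuous_normedSpace_rng ℂ rapid_withSeminorms f
    ⟨{n}, ⟨wNorm (-n) η.seq, wNorm_nonneg _ _⟩, fun ξ => ?_⟩
  rw [Finset.sup_singleton]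
  have := norm_pairing_le (ξ.wsummable n) hn
  rw [mul_comm] at this
  exact this

theorem seq_sum_unitVec (η : Slow) (F : Finset ℕ+) (i : ℕ+) :
    (∑ j ∈ F, η.seq j • unitVec j).seq i = if i ∈ F then η.seq i else 0 := by
  classical
  induction F using Finset.induction_on with
  | empty => simp [Slow.seq_zero]
  | insert a F ha ih =>
    rw [Finset.sum_insert ha, Slow.seq_add, Pi.add_apply, ih, Slow.seq_smul, unitVec_seq]
    by_cases hi : i = a
    · subst hi; simp [ha]
    · simp [hi]

/-- Every element of `s'` is the sum of its coordinate series. -/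
theorem hasSum_unitVec (η : Slow) : HasSum (fun j => η.seq j • unitVec j) η := by
  classical
  obtain ⟨n, hn⟩ := η.wsummable
  refine (slow_withSeminorms.tendsto_nhds _ _).2 fun B ε hε => ?_
  obtain ⟨C, hC, hB⟩ := bddRapid_bound B.2 n
  have ht := tendsto_tsum_compl_atTop_zero
    fun j : ℕ+ => ‖η.seq j‖ ^ 2 * (j : ℝ) ^ (2 * (-(n : ℤ)))
  have hd : (0 : ℝ) < (ε / (2 * C)) ^ 2 := by positivity
  filter_upwards [ht.eventually (gt_mem_nhds hd)] with F hF
  set ζ : Slow := (∑ j ∈ F, η.seq j • unitVec j) - η with hζ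
  have hseq : ∀ i, ‖ζ.seq i‖ ^ 2 * (i : ℝ) ^ (2 * (-(n : ℤ))) =
      Set.indicator {j | j ∉ F} (fun j : ℕ+ => ‖η.seq j‖ ^ 2 * (j : ℝ) ^ (2 * (-(n : ℤ)))) i := by
    intro i
    have h1 : ζ.seq i = (∑ j ∈ F, η.seq j • unitVec j).seq i - η.seq i := rfl
    rw [h1, seq_sum_unitVec]
    by_cases hi : i ∈ F <;> simp [hi]
  have hsum : WSummable (-n) ζ.seq := (Summable.indicator hn {j | j ∉ F}).congr
    fun i => (hseq i).symm
  have hnorm : wNorm (-n) ζ.seq ≤ ε / (2 * C) := by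
    refine Real.sqrt_le_iff.2 ⟨by positivity, ?_⟩
    rw [tsum_congr hseq, ← tsum_subtype {j | j ∉ F}
      fun j : ℕ+ => ‖η.seq j‖ ^ 2 * (j : ℝ) ^ (2 * (-(n : ℤ)))]
    exact hF.le
  refine lt_of_le_of_lt (slowSeminorm_le B ζ (C := ε / 2) (by positivity) fun ξ hξ => ?_)
    (half_lt_self hε)
  calc _ ≤ wNorm n ξ.seq * wNorm (-n) ζ.seq := norm_pairing_le (ξ.wsummable n) hsum
    _ ≤ C * (ε / (2 * C)) := mul_le_mul (hB ξ hξ) hnorm (wNorm_nonneg _ _) hC.le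
    _ = ε / 2 := by field_simp

/-- `⟨x* ξ, η⟩ = ⟨ξ, x η⟩` for all `ξ, η ∈ s'`. -/
theorem star_spec (x : Schw) (ξ η : Slow) :
    pairing (star x ξ).seq η.seq = pairing ξ.seq (x η).seq := by
  let f : Rapid →L[ℂ] ℂ :=
    { toFun := fun ζ => pairing ζ.seq ξ.seq
      map_add' := fun ζ ζ' => pairing_add_left ζ ζ' ξ
      map_smul' := fun c ζ => pairing_smul_left c ζ.seq ξ.seq
      cont := continuous_pairing ξ }
  have h := (hasSum_unitVec η).mapL (f.comp x)
  have h2 : pairing (x η).seq ξ.seq = ∑' j, η.seq j * pairing (x (unitVec j)).seq ξ.seq := by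
    refine (h.tsum_eq.symm.trans (tsum_congr fun j => ?_) : (f.comp x) η = _)
    rw [map_smul, smul_eq_mul]
    rfl
  rw [← pairing_conj η.seq, ← pairing_conj (x η).seq, h2]
  congr 1
  exact tsum_congr fun j => by rw [star_seq, pairing_conj]

/-- The norm `‖x‖_n = sup {|x ξ|_n : ξ ∈ U_n°}` on `𝒮`, as an extended nonnegative real. -/
def opNorm (n : ℕ) (x : Schw) : ℝ≥0∞ :=
  ⨆ ξ ∈ polarBall n, ENNReal.ofReal (rapidNorm n (x ξ))

/-- `‖u‖*_n = sup {|u(x,y)| : ‖x‖_n ≤ 1, ‖y‖_n ≤ 1}` for a bilinear form `u` on `𝒮 × 𝒮`; it may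
be infinite. -/
def bilinNorm (n : ℕ) (u : Schw →ₗ[ℂ] Schw →ₗ[ℂ] ℂ) : ℝ≥0∞ :=
  ⨆ (x : Schw) (y : Schw) (_ : opNorm n x ≤ 1) (_ : opNorm n y ≤ 1), ‖u x y‖ₑ

/-- Continuity of a bilinear form as a function of two variables. -/
def ContinuousBilin (u : Schw →ₗ[ℂ] Schw →ₗ[ℂ] ℂ) : Prop :=
  Continuous fun p : Schw × Schw => u p.1 p.2

/-- `‖(x_j)‖_k^{RC} = max {‖∑ x_j* x_j‖_k^{1/2}, ‖∑ x_j x_j*‖_k^{1/2}}`. -/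
def rcNorm (k : ℕ) {m : ℕ} (x : Fin m → Schw) : ℝ≥0∞ :=
  max (opNorm k (∑ j, star (x j) * x j) ^ (1 / 2 : ℝ))
    (opNorm k (∑ j, x j * star (x j)) ^ (1 / 2 : ℝ))

/-- Grothendieck's inequality in `𝒮` with parameters `n`, `k` and constant `C`. -/
def GrothendieckIneq (n k : ℕ) (C : ℝ≥0∞) : Prop :=
  ∀ u : Schw →ₗ[ℂ] Schw →ₗ[ℂ] ℂ, ContinuousBilin u →
    ∀ (m : ℕ) (x y : Fin m → Schw),
      ‖∑ j, u (x j) (y j)‖ₑ ≤ C * bilinNorm n u * rcNorm k x * rcNorm k y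

/-- `K_n`: the best constant in Grothendieck's inequality with `k = 2n+1`. -/
def bestConst (n : ℕ) : ℝ≥0∞ := sInf {C | GrothendieckIneq n (2 * n + 1) C}

/-- `K = sup_{n ≥ 1} K_n`. -/
def grothendieckConst : ℝ≥0∞ := ⨆ (n : ℕ) (_ : 1 ≤ n), bestConst n

/-- The vector functional `φ_ξ(x) = ⟨x ξ, ξ⟩` as an element of `𝒮'` with the weak* topology. -/
def vecFunctional (ξ : Slow) : WeakDual ℂ Schw :=
  StrongDual.toWeakDual
    { toFun := fun x => pairing (x ξ).seq ξ.seq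
      map_add' := fun x y => pairing_add_left (x ξ) (y ξ) ξ
      map_smul' := fun c x => pairing_smul_left c (x ξ).seq ξ.seq
      cont := (continuous_pairing ξ).comp (continuous_eval_const ξ) }

theorem vecFunctional_apply (ξ : Slow) (x : Schw) :
    vecFunctional ξ x = pairing (x ξ).seq ξ.seq := rfl

/-- The set of `n`-states: the (weak*) closed convex hull of `{φ_ξ : ξ ∈ U_n°}` in `𝒮'`. -/
def nStates (n : ℕ) : Set (WeakDual ℂ Schw) :=
  closure (convexHull ℝ (vecFunctional '' polarBall n))

end NCSchwartz

end

open NCSchwartz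

/-! The inequality with constant π²/6 is a Hilbert–Schmidt estimate. View `x` as a matrix with
entries x_ab = (x e_b)_a. Cauchy–Schwarz gives ‖x‖_n² ≤ ∑ |x_ab|² a^{2n} b^{2n}, and 2 a^{2n} b^{2n}
≤ a^{4n} + b^{4n} splits this into a weighted sum over columns and one over rows
(`two_mul_opNorm_sq_le`). For a family x_j, the squared b-th columns add up to the b-th diagonal
entry of ∑ x_j* x_j, which is at most b^{-2k} ‖∑ x_j* x_j‖_k (`sum_colSq_le`); rows are treated
through x_j*. With k = 2n+1 the weights leave b^{-2}, so ∑ ‖x_j‖_n² ≤ ζ(2) (‖(x_j)‖_k^{RC})²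
(`sum_opNorm_sq_le`). Bounding |u(x_j, y_j)| by ‖u‖_n^* ‖x_j‖_n ‖y_j‖_n and applying Cauchy–Schwarz
over j finishes this half.

The factorization through states is a Hahn–Banach argument. The k-states form a compact convex set
on which ‖∑ x_j* x_j‖_k is dominated by a value φ(∑ x_j* x_j) (`exists_nStates_opNorm_le`). The
inequality for finite families therefore says that every nonnegative combination of the affine
functions A(φ₁(x*x) + φ₂(xx*) + ψ₁(y*y) + ψ₂(yy*)) - 2|u(x,y)|, with A = K‖u‖_n^*, is nonnegative at
some quadruple of states. Separation and compactness give one quadruple that serves all x, y, and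
replacing (x, y) by (tx, t⁻¹y) turns the sum into a product.

If ‖u‖_n^* = ∞, the right-hand side has to be infinite for all nonzero x and y despite the
convention 0·∞ = 0; this follows from a faithful state and K ≠ 0. -/

namespace NCSchwartz

/-! ### Matrix entries, the involution and the pairing -/

theorem schw_ext {x y : Schw} (h : ∀ ξ i, (x ξ).seq i = (y ξ).seq i) : x = y :=
  ContinuousLinearMap.ext fun ξ => Subtype.ext (funext fun i => h ξ i)

/-- The i-th row of the matrix of `x` is, up to conjugation, the i-th column of `star x`. Since that
column lies in `s`, coordinates of `x ξ` can be estimated by the pairing of `s` with `s'`. -/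
theorem apply_seq_eq_pairing_star (x : Schw) (ξ : Slow) (i : ℕ+) :
    (x ξ).seq i = pairing ξ.seq (star x (unitVec i)).seq := by
  rw [← pairing_conj, star_spec, pairing_conj, pairing_unitVec]

theorem star_unitVec_seq (x : Schw) (i j : ℕ+) :
    (star x (unitVec i)).seq j = conj ((x (unitVec j)).seq i) := by
  rw [star_seq, ← pairing_conj, pairing_unitVec]

theorem star_star_schw (x : Schw) : star (star x) = x :=
  schw_ext fun ξ i => by rw [star_seq, ← apply_seq_eq_pairing_star]

theorem star_smul_schw (c : ℂ) (x : Schw) : star (c • x) = conj c • star x :=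
  schw_ext fun ξ i => by
    rw [star_seq, smul_apply, smul_apply, Rapid.seq_smul,
      Rapid.seq_smul, Pi.smul_apply, star_seq, smul_eq_mul, ← pairing_conj, pairing_smul_left,
      map_mul, pairing_conj]

theorem smul_mul_smul_schw (c d : ℂ) (x y : Schw) : (c • x) * (d • y) = (c * d) • (x * y) := by
  ext ξ
  rw [mul_apply, smul_apply, smul_apply,
    smul_apply, map_smul, map_smul, smul_smul, mul_apply]

/-- Vanishing columns of `x` mean vanishing rows of `star x`, entry by entry, and the coordinates of
`x ξ` are pairings with the vectors `star x e_i`. No density argument is needed at this point. -/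
theorem schw_eq_zero {x : Schw} (h : ∀ i, x (unitVec i) = 0) : x = 0 := by
  refine schw_ext fun ξ i => ?_
  have h0 : (star x (unitVec i)).seq = 0 := by
    funext j
    rw [star_unitVec_seq, h, Rapid.seq_zero, Pi.zero_apply, map_zero, Pi.zero_apply]
  rw [apply_seq_eq_pairing_star, h0]
  simp [pairing, Rapid.seq_zero]

theorem exists_entry_ne_zero {x : Schw} (hx : x ≠ 0) : ∃ i j, (x (unitVec i)).seq j ≠ 0 := by
  by_contra! h
  exact hx (schw_eq_zero fun i => Subtype.ext (funext (h i)))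

theorem norm_entry_le_wNorm (n : ℕ) (ξ : Rapid) (j : ℕ+) : ‖ξ.seq j‖ ≤ wNorm n ξ.seq := by
  refine le_trans ?_ (wNorm_coord_le (ξ.wsummable n) j)
  have : (1 : ℝ) ≤ j := by exact_mod_cast Nat.succ_le_of_lt j.pos
  exact le_mul_of_one_le_right (norm_nonneg _) (one_le_zpow₀ this (by simp))

theorem pairing_sum_left {ι : Type*} (s : Finset ι) (f : ι → Rapid) (η : Slow) :
    pairing (∑ j ∈ s, f j).seq η.seq = ∑ j ∈ s, pairing (f j).seq η.seq := by
  classical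
  induction s using Finset.induction_on with
  | empty => simp [Rapid.seq_zero, pairing]
  | insert a s ha ih => rw [Finset.sum_insert ha, Finset.sum_insert ha, pairing_add_left, ih]

theorem pairing_star_mul (x : Schw) (ξ η : Slow) :
    pairing ((star x * x) ξ).seq η.seq = pairing (x ξ).seq (x η).seq := by
  rw [mul_apply, star_spec, incl_seq]

theorem pairing_self (ξ : Rapid) : pairing ξ.seq ξ.seq = ((wNorm 0 ξ.seq ^ 2 : ℝ) : ℂ) := by
  rw [wNorm_sq, Complex.ofReal_tsum, pairing]
  refine tsum_congr fun j => ?_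
  rw [Complex.mul_conj, Complex.normSq_eq_norm_sq]
  simp

theorem vecFunctional_star_mul (x : Schw) (ξ : Slow) :
    vecFunctional ξ (star x * x) = ((wNorm 0 (x ξ).seq ^ 2 : ℝ) : ℂ) := by
  rw [vecFunctional_apply, pairing_star_mul, pairing_self]

theorem norm_pairing_zero_le (ξ η : Rapid) :
    ‖pairing ξ.seq η.seq‖ ≤ wNorm 0 ξ.seq * wNorm 0 η.seq := by
  have h := norm_pairing_le (k := 0) (ξ.wsummable 0) (by simpa using η.wsummable 0)
  rwa [neg_zero] at h

/-! ### Bounds for the norms on `𝒮` -/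

theorem isVonNBounded_polarBall (n : ℕ) : Bornology.IsVonNBounded ℂ (polarBall n) := by
  rw [slow_withSeminorms.isVonNBounded_iff_seminorm_bounded]
  intro B
  obtain ⟨C, hC, h⟩ := bddRapid_bound B.2 n
  refine ⟨C + 1, by linarith, fun η hη => lt_of_le_of_lt ?_ (lt_add_one C)⟩
  refine slowSeminorm_le B _ hC.le fun ξ hξ => (norm_pairing_le (ξ.wsummable n) hη.1).trans ?_
  exact (mul_le_mul (h ξ hξ) hη.2 (wNorm_nonneg _ _) hC.le).trans_eq (mul_one C)

theorem ofReal_le_opNorm {n : ℕ} (x : Schw) {ξ : Slow} (hξ : ξ ∈ polarBall n) :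
    ENNReal.ofReal (wNorm n (x ξ).seq) ≤ opNorm n x :=
  le_iSup₂ (f := fun ξ (_ : ξ ∈ polarBall n) => ENNReal.ofReal (rapidNorm n (x ξ))) ξ hξ

theorem opNorm_le {n : ℕ} {x : Schw} {C : ℝ≥0∞}
    (h : ∀ ξ ∈ polarBall n, ENNReal.ofReal (wNorm n (x ξ).seq) ≤ C) : opNorm n x ≤ C :=
  iSup₂_le h

theorem opNorm_ne_top (n : ℕ) (x : Schw) : opNorm n x ≠ ∞ := by
  obtain ⟨C, hC, h⟩ := bddRapid_bound ((isVonNBounded_polarBall n).image x) n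
  refine ne_top_of_le_ne_top ENNReal.ofReal_ne_top (opNorm_le (C := ENNReal.ofReal C) fun ξ hξ => ?_)
  exact ENNReal.ofReal_le_ofReal (h _ ⟨ξ, hξ, rfl⟩)

theorem wNorm_le_toReal_opNorm {n : ℕ} (x : Schw) {ξ : Slow} (hξ : ξ ∈ polarBall n) :
    wNorm n (x ξ).seq ≤ (opNorm n x).toReal :=
  (ENNReal.ofReal_le_iff_le_toReal (opNorm_ne_top n x)).1 (ofReal_le_opNorm x hξ)

theorem opNorm_smul (n : ℕ) (c : ℂ) (x : Schw) : opNorm n (c • x) = ‖c‖ₑ * opNorm n x := by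
  have h : ∀ ξ, ENNReal.ofReal (rapidNorm n ((c • x) ξ)) =
      ‖c‖ₑ * ENNReal.ofReal (rapidNorm n (x ξ)) := fun ξ => by
    rw [smul_apply, map_smul_eq_mul, ENNReal.ofReal_mul (norm_nonneg c),
      ofReal_norm]
  simp only [opNorm, h, ENNReal.mul_iSup]

theorem scaled_unitVec_mem_polarBall (k : ℕ) (b : ℕ+) :
    ((b : ℂ) ^ k) • unitVec b ∈ polarBall k := by
  have h : ∀ j, ‖(((b : ℂ) ^ k) • unitVec b).seq j‖ ^ 2 * (j : ℝ) ^ (2 * (-k : ℤ)) =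
      if j = b then 1 else 0 := by
    intro j
    rw [Slow.seq_smul, unitVec_seq]
    by_cases hj : j = b
    · subst hj
      have := (pos_cast j).ne'
      rw [term_eq]
      simp [this]
    · simp [hj]
  refine ⟨?_, ?_⟩
  · rw [WSummable]
    simp_rw [h]
    exact (hasSum_ite_eq b (1 : ℝ)).summable
  · rw [wNorm]
    simp_rw [h]
    simp

theorem unitVec_mem_polarBall (k : ℕ) (b : ℕ+) : unitVec b ∈ polarBall k := by
  have h0 := scaled_unitVec_mem_polarBall 0 b
  rw [pow_zero, one_smul] at h0
  refine ⟨h0.1.mono (by simp), le_trans (Real.sqrt_le_sqrt ?_) h0.2⟩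
  refine Summable.tsum_le_tsum (fun j => ?_) (h0.1.mono (by simp)) h0.1
  have : (1 : ℝ) ≤ j := by exact_mod_cast Nat.succ_le_of_lt j.pos
  gcongr
  simp

theorem zero_mem_polarBall (k : ℕ) : (0 : Slow) ∈ polarBall k :=
  ⟨WSummable.zero _, by rw [Slow.seq_zero, wNorm_zero]; exact zero_le_one⟩

theorem eq_zero_of_opNorm_eq_zero {n : ℕ} {x : Schw} (h : opNorm n x = 0) : x = 0 := by
  by_contra hx
  obtain ⟨i, j, hj⟩ := exists_entry_ne_zero hx
  have h1 := (norm_entry_le_wNorm n _ j).trans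
    (wNorm_le_toReal_opNorm x (unitVec_mem_polarBall n i))
  rw [h, ENNReal.toReal_zero] at h1
  exact hj (norm_le_zero_iff.1 h1)

/-- Homogeneity reduces this to the unit ball. The case of zero norm is separate because `bilinNorm
n u` may be ∞ and ∞·0 = 0; there the argument itself is zero. -/
theorem enorm_apply_le (n : ℕ) (u : Schw →ₗ[ℂ] Schw →ₗ[ℂ] ℂ) (x y : Schw) :
    ‖u x y‖ₑ ≤ bilinNorm n u * opNorm n x * opNorm n y := by
  by_cases hx : opNorm n x = 0
  · simp [eq_zero_of_opNorm_eq_zero hx]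
  by_cases hy : opNorm n y = 0
  · simp [eq_zero_of_opNorm_eq_zero hy]
  have key : ∀ z : Schw, opNorm n z ≠ 0 → ∃ w : Schw, ∃ c : ℂ,
      z = c • w ∧ ‖c‖ₑ = opNorm n z ∧ opNorm n w ≤ 1 := by
    intro z hz
    have hp : 0 < (opNorm n z).toReal := ENNReal.toReal_pos hz (opNorm_ne_top n z)
    have hc : ((opNorm n z).toReal : ℂ) ≠ 0 := by exact_mod_cast hp.ne'
    have he : ‖((opNorm n z).toReal : ℂ)‖ₑ = opNorm n z := by
      rw [← ofReal_norm, Complex.norm_real, Real.norm_of_nonneg hp.le,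
        ENNReal.ofReal_toReal (opNorm_ne_top n z)]
    refine ⟨((opNorm n z).toReal : ℂ)⁻¹ • z, _, (smul_inv_smul₀ hc z).symm, he, ?_⟩
    rw [opNorm_smul, enorm_inv hc, he, ENNReal.inv_mul_cancel hz (opNorm_ne_top n z)]
  obtain ⟨x', c, hx1, hc, hx2⟩ := key x hx
  obtain ⟨y', d, hy1, hd, hy2⟩ := key y hy
  have h : ‖u x' y'‖ₑ ≤ bilinNorm n u :=
    le_iSup_of_le x' (le_iSup_of_le y' (le_iSup_of_le hx2 (le_iSup_of_le hy2 le_rfl)))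
  rw [← hc, ← hd, hx1, hy1, map_smul, map_smul, LinearMap.smul_apply, smul_eq_mul, smul_eq_mul,
    enorm_mul, enorm_mul]
  calc _ ≤ ‖d‖ₑ * (‖c‖ₑ * bilinNorm n u) := by gcongr
    _ = _ := by ring

theorem ennreal_rpow_half_sq (a : ℝ≥0∞) : (a ^ (1 / 2 : ℝ)) ^ 2 = a := by
  rw [← ENNReal.rpow_natCast, ← ENNReal.rpow_mul]; norm_num

/-! ### Hilbert–Schmidt estimates -/

/-- The sum `∑ᵢ |⟨x e_b, e_i⟩|²` of the squared entries in a column. -/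
noncomputable def colSq (x : Schw) (b : ℕ+) : ℝ≥0∞ := ∑' a : ℕ+, ‖(x (unitVec b)).seq a‖ₑ ^ 2

theorem enorm_sq_mul_cast (z : ℂ) (a : ℕ+) (k : ℕ) :
    ENNReal.ofReal (‖z‖ ^ 2 * (a : ℝ) ^ (2 * (k : ℤ))) = ‖z‖ₑ ^ 2 * (a : ℝ≥0∞) ^ (2 * k) := by
  have h1 : (a : ℝ) ^ (2 * (k : ℤ)) = (a : ℝ) ^ (2 * k) := by exact_mod_cast zpow_natCast (a : ℝ) _
  rw [h1, ENNReal.ofReal_mul (by positivity), ENNReal.ofReal_pow (norm_nonneg _),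
    ENNReal.ofReal_pow (pos_cast a).le, ofReal_norm, ENNReal.ofReal_natCast]

theorem ofReal_wNorm_sq (k : ℕ) (ξ : Rapid) : ENNReal.ofReal (wNorm k ξ.seq ^ 2) =
    ∑' a : ℕ+, ‖ξ.seq a‖ₑ ^ 2 * (a : ℝ≥0∞) ^ (2 * k) := by
  rw [wNorm_sq, ENNReal.ofReal_tsum_of_nonneg (term_nonneg k _) (ξ.wsummable k)]
  exact tsum_congr fun a => enorm_sq_mul_cast _ a k

theorem colSq_eq (x : Schw) (b : ℕ+) :
    colSq x b = ENNReal.ofReal (wNorm 0 (x (unitVec b)).seq ^ 2) := by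
  have h := ofReal_wNorm_sq 0 (x (unitVec b))
  simp only [Nat.cast_zero] at h
  simp [h, colSq]

theorem colSq_star (x : Schw) (a : ℕ+) :
    colSq (star x) a = ∑' b : ℕ+, ‖(x (unitVec b)).seq a‖ₑ ^ 2 := by
  refine tsum_congr fun b => ?_
  rw [star_unitVec_seq, RCLike.enorm_conj]

/-- The a-th coordinate of `x ξ` is the pairing of `ξ` with `star x e_a`, so on the polar of U_n it
is at most |x* e_a|_n; then the squares are summed over a with weight a^{2n}. -/
theorem opNorm_sq_le_tsum (n : ℕ) (x : Schw) : opNorm n x ^ 2 ≤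
    ∑' a : ℕ+, ∑' b : ℕ+, ‖(x (unitVec b)).seq a‖ₑ ^ 2 * (b : ℝ≥0∞) ^ (2 * n) *
      (a : ℝ≥0∞) ^ (2 * n) := by
  have h : opNorm n x ≤ (∑' a : ℕ+, ∑' b : ℕ+, ‖(x (unitVec b)).seq a‖ₑ ^ 2 *
      (b : ℝ≥0∞) ^ (2 * n) * (a : ℝ≥0∞) ^ (2 * n)) ^ (1 / 2 : ℝ) := by
    refine opNorm_le fun ξ hξ => ?_
    rw [← ENNReal.rpow_le_rpow_iff (z := 2) two_pos, ← ENNReal.rpow_mul]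
    norm_num
    rw [← ENNReal.ofReal_pow (wNorm_nonneg _ _), ofReal_wNorm_sq]
    gcongr with a
    rw [ENNReal.tsum_mul_right]
    gcongr
    have h1 : ‖(x ξ).seq a‖ ≤ wNorm n (star x (unitVec a)).seq := by
      rw [apply_seq_eq_pairing_star, ← pairing_conj, RCLike.norm_conj]
      refine (norm_pairing_le (Rapid.wsummable _ n) hξ.1).trans ?_
      exact mul_le_of_le_one_right (wNorm_nonneg _ _) hξ.2
    calc ‖(x ξ).seq a‖ₑ ^ 2 ≤ ENNReal.ofReal (wNorm n (star x (unitVec a)).seq) ^ 2 := by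
          rw [← ofReal_norm]; gcongr
      _ = _ := by
          rw [← ENNReal.ofReal_pow (wNorm_nonneg _ _), ofReal_wNorm_sq]
          refine tsum_congr fun b => ?_
          rw [star_unitVec_seq, RCLike.enorm_conj]
  calc opNorm n x ^ 2 ≤ _ ^ 2 := by gcongr
    _ = _ := ennreal_rpow_half_sq _

/-- The mixed weight is split by 2 a^{2n} b^{2n} ≤ a^{4n} + b^{4n}, so that each sum carries a
weight in one index only. This is where the order doubles from n to 2n. -/
theorem two_mul_opNorm_sq_le (n : ℕ) (x : Schw) : 2 * opNorm n x ^ 2 ≤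
    (∑' b : ℕ+, colSq x b * (b : ℝ≥0∞) ^ (4 * n)) +
      ∑' a : ℕ+, colSq (star x) a * (a : ℝ≥0∞) ^ (4 * n) := by
  have hE : ∑' b : ℕ+, colSq x b * (b : ℝ≥0∞) ^ (4 * n) = ∑' a : ℕ+, ∑' b : ℕ+,
      ‖(x (unitVec b)).seq a‖ₑ ^ 2 * (b : ℝ≥0∞) ^ (4 * n) := by
    rw [ENNReal.tsum_comm]
    simp only [ENNReal.tsum_mul_right, colSq]
  have hF : ∑' a : ℕ+, colSq (star x) a * (a : ℝ≥0∞) ^ (4 * n) = ∑' a : ℕ+, ∑' b : ℕ+,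
      ‖(x (unitVec b)).seq a‖ₑ ^ 2 * (a : ℝ≥0∞) ^ (4 * n) := by
    simp only [ENNReal.tsum_mul_right, colSq_star]
  rw [hE, hF, ← ENNReal.tsum_add]
  refine (mul_le_mul_right (opNorm_sq_le_tsum n x) 2).trans ?_
  rw [← ENNReal.tsum_mul_left]
  gcongr with a
  rw [← ENNReal.tsum_mul_left, ← ENNReal.tsum_add]
  gcongr with b
  have h : 2 * ((b : ℝ≥0∞) ^ (2 * n) * (a : ℝ≥0∞) ^ (2 * n)) ≤
      (b : ℝ≥0∞) ^ (4 * n) + (a : ℝ≥0∞) ^ (4 * n) := by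
    have := two_mul_le_add_sq ((b : ℕ) ^ (2 * n)) ((a : ℕ) ^ (2 * n))
    have h2 : 2 * ((b : ℕ) ^ (2 * n) * (a : ℕ) ^ (2 * n)) ≤ (b : ℕ) ^ (4 * n) + (a : ℕ) ^ (4 * n) := by
      refine (le_of_eq (by ring)).trans (this.trans_eq ?_)
      rw [← pow_mul, ← pow_mul]; ring_nf
    exact_mod_cast h2
  calc _ = ‖(x (unitVec b)).seq a‖ₑ ^ 2 * (2 * ((b : ℝ≥0∞) ^ (2 * n) * (a : ℝ≥0∞) ^ (2 * n))) := by
        ring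
    _ ≤ ‖(x (unitVec b)).seq a‖ₑ ^ 2 * ((b : ℝ≥0∞) ^ (4 * n) + (a : ℝ≥0∞) ^ (4 * n)) := by gcongr
    _ = _ := by ring

theorem pairing_sum_star_mul {m : ℕ} (x : Fin m → Schw) (ξ η : Slow) :
    pairing ((∑ j, star (x j) * x j) ξ).seq η.seq = ∑ j, pairing (x j ξ).seq (x j η).seq := by
  rw [sum_apply, pairing_sum_left]
  exact Finset.sum_congr rfl fun j _ => pairing_star_mul _ _ _

/-- The left side equals ⟨Tξ, ξ⟩ for T = ∑ x_j* x_j, which is at most |Tξ|_k |ξ|'_k. -/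
theorem sum_wNorm_sq_le_opNorm {k m : ℕ} (x : Fin m → Schw) {ξ : Slow} (hξ : ξ ∈ polarBall k) :
    ∑ j, wNorm 0 (x j ξ).seq ^ 2 ≤ (opNorm k (∑ j, star (x j) * x j)).toReal := by
  have h : ((∑ j, wNorm 0 (x j ξ).seq ^ 2 : ℝ) : ℂ) =
      pairing ((∑ j, star (x j) * x j) ξ).seq ξ.seq := by
    rw [pairing_sum_star_mul, Complex.ofReal_sum]
    exact Finset.sum_congr rfl fun j _ => (pairing_self _).symm
  have h2 := norm_pairing_le (((∑ j, star (x j) * x j) ξ).wsummable k) hξ.1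
  rw [← h, Complex.norm_real] at h2
  refine (le_abs_self _).trans (h2.trans ?_)
  refine (mul_le_of_le_one_right (wNorm_nonneg _ _) hξ.2).trans ?_
  exact wNorm_le_toReal_opNorm _ hξ

/-- The quadratic form of ∑ x_j* x_j is tested on b^k e_b, which has dual norm |·|'_k equal to 1;
the scaling produces b^{2k}. -/
theorem sum_colSq_le {k m : ℕ} (x : Fin m → Schw) (b : ℕ+) :
    (∑ j, colSq (x j) b) * (b : ℝ≥0∞) ^ (2 * k) ≤ opNorm k (∑ j, star (x j) * x j) := by
  have h := sum_wNorm_sq_le_opNorm x (scaled_unitVec_mem_polarBall k b)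
  rw [← ENNReal.ofReal_le_iff_le_toReal (opNorm_ne_top _ _)] at h
  refine le_trans (le_of_eq ?_) h
  rw [ENNReal.ofReal_sum_of_nonneg fun j _ => sq_nonneg _, Finset.sum_mul]
  refine Finset.sum_congr rfl fun j _ => ?_
  rw [map_smul, Rapid.seq_smul, wNorm_smul, mul_pow, colSq_eq, mul_comm,
    ENNReal.ofReal_mul (sq_nonneg _)]
  congr 1
  rw [norm_pow, Complex.norm_natCast, ← pow_mul, ENNReal.ofReal_pow (pos_cast b).le,
    ENNReal.ofReal_natCast, mul_comm k 2]

theorem tsum_inv_sq_pnat : ∑' b : ℕ+, ((b : ℝ≥0∞) ^ 2)⁻¹ = ENNReal.ofReal (Real.pi ^ 2 / 6) := by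
  have h := hasSum_zeta_two
  have h2 : HasSum (fun b : ℕ+ => 1 / ((b : ℕ) : ℝ) ^ 2) (Real.pi ^ 2 / 6) := by
    refine (Function.Injective.hasSum_iff PNat.coe_injective (f := fun n : ℕ => 1 / (n : ℝ) ^ 2)
      fun n hn => ?_).2 h
    rcases Nat.eq_zero_or_pos n with rfl | hp
    · simp
    · exact absurd ⟨⟨n, hp⟩, rfl⟩ hn
  rw [← h2.tsum_eq, ENNReal.ofReal_tsum_of_nonneg (fun b => by positivity) h2.summable]
  refine tsum_congr fun b => ?_
  have := pos_cast b
  rw [one_div, ENNReal.ofReal_inv_of_pos (by positivity), ENNReal.ofReal_pow this.le,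
    ENNReal.ofReal_natCast]

/-- Origin of both 2n+1 and π²/6: the column bound at k = 2n+1 decays like b^{-(4n+2)}, so after
multiplication by b^{4n} the convergent sum ζ(2) of b^{-2} remains. -/
theorem sum_tsum_colSq_le {n m : ℕ} (x : Fin m → Schw) :
    ∑ j, ∑' b : ℕ+, colSq (x j) b * (b : ℝ≥0∞) ^ (4 * n) ≤
      ENNReal.ofReal (Real.pi ^ 2 / 6) * opNorm (2 * n + 1) (∑ j, star (x j) * x j) := by
  rw [← Summable.tsum_finsetSum fun _ _ => ENNReal.summable, ← tsum_inv_sq_pnat,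
    ← ENNReal.tsum_mul_right]
  gcongr with b
  have hb : (b : ℝ≥0∞) ^ 2 ≠ 0 := by simp
  have hb' : (b : ℝ≥0∞) ^ 2 ≠ ∞ := by finiteness
  rw [← Finset.sum_mul, mul_comm _ (opNorm _ _), ← div_eq_mul_inv,
    ENNReal.le_div_iff_mul_le (Or.inl hb) (Or.inl hb'), mul_assoc, ← pow_add]
  have h := sum_colSq_le (k := 2 * n + 1) x b
  rwa [show 2 * (2 * n + 1) = 4 * n + 2 by ring] at h

/-! ### Grothendieck's inequality and its best constant -/

theorem rcNorm_sq {k m : ℕ} (x : Fin m → Schw) : rcNorm k x ^ 2 =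
    max (opNorm k (∑ j, star (x j) * x j)) (opNorm k (∑ j, x j * star (x j))) := by
  have hm : Monotone fun a : ℝ≥0∞ => a ^ 2 := fun a b hab => by dsimp only; gcongr
  rw [rcNorm, hm.map_max, ennreal_rpow_half_sq, ennreal_rpow_half_sq]

theorem rcNorm_ne_top {k m : ℕ} (x : Fin m → Schw) : rcNorm k x ≠ ∞ := by
  intro h
  have h2 := rcNorm_sq (k := k) x
  rw [h] at h2
  have : max (opNorm k (∑ j, star (x j) * x j)) (opNorm k (∑ j, x j * star (x j))) ≠ ∞ := by
    simp [opNorm_ne_top]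
  exact this (h2 ▸ by simp)

theorem sum_opNorm_sq_le (n : ℕ) {m : ℕ} (x : Fin m → Schw) :
    ∑ j, opNorm n (x j) ^ 2 ≤ ENNReal.ofReal (Real.pi ^ 2 / 6) * rcNorm (2 * n + 1) x ^ 2 := by
  have h1 := sum_tsum_colSq_le (n := n) x
  have h2 := sum_tsum_colSq_le (n := n) fun j => star (x j)
  simp only [star_star_schw] at h2
  have h3 : 2 * ∑ j, opNorm n (x j) ^ 2 ≤
      2 * (ENNReal.ofReal (Real.pi ^ 2 / 6) * rcNorm (2 * n + 1) x ^ 2) := by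
    rw [Finset.mul_sum]
    refine (Finset.sum_le_sum fun j _ => two_mul_opNorm_sq_le n (x j)).trans ?_
    rw [Finset.sum_add_distrib, two_mul, rcNorm_sq]
    gcongr
    · exact h1.trans (by gcongr; exact le_max_left _ _)
    · exact h2.trans (by gcongr; exact le_max_right _ _)
  exact (ENNReal.mul_le_mul_iff_right (by simp) (by simp)).1 h3

/-- Grothendieck's inequality in `𝒮` with the constant `π²/6`. -/
theorem grothendieckIneq_pi_sq_div_six (n : ℕ) :
    GrothendieckIneq n (2 * n + 1) (ENNReal.ofReal (Real.pi ^ 2 / 6)) := by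
  intro u _ m x y
  set ζ := ENNReal.ofReal (Real.pi ^ 2 / 6)
  have hroot : ∀ z : Fin m → Schw, (∑ j, opNorm n (z j) ^ (2 : ℝ)) ^ (1 / 2 : ℝ) ≤
      ζ ^ (1 / 2 : ℝ) * rcNorm (2 * n + 1) z := fun z => by
    have h := sum_opNorm_sq_le n z
    calc _ ≤ (ζ * rcNorm (2 * n + 1) z ^ 2) ^ (1 / 2 : ℝ) := by
          gcongr; simpa only [ENNReal.rpow_two] using h
      _ = _ := by
          rw [ENNReal.mul_rpow_of_nonneg _ _ (by norm_num), ← ENNReal.rpow_natCast (_) 2,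
            ← ENNReal.rpow_mul]
          norm_num
  -- The absolute value goes inside the sum: the square-summability of ‖x_j‖_n makes cancellation
  -- irrelevant.
  calc ‖∑ j, u (x j) (y j)‖ₑ ≤ ∑ j, ‖u (x j) (y j)‖ₑ := enorm_sum_le _ _
    _ ≤ ∑ j, bilinNorm n u * (opNorm n (x j) * opNorm n (y j)) :=
        Finset.sum_le_sum fun j _ => (enorm_apply_le n u _ _).trans_eq (mul_assoc _ _ _)
    _ = bilinNorm n u * ∑ j, opNorm n (x j) * opNorm n (y j) := by rw [Finset.mul_sum]
    _ ≤ bilinNorm n u * ((∑ j, opNorm n (x j) ^ (2 : ℝ)) ^ (1 / 2 : ℝ) *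
          (∑ j, opNorm n (y j) ^ (2 : ℝ)) ^ (1 / 2 : ℝ)) := by
        gcongr
        exact ENNReal.inner_le_Lp_mul_Lq _ _ _ Real.HolderConjugate.two_two
    _ ≤ bilinNorm n u * ((ζ ^ (1 / 2 : ℝ) * rcNorm (2 * n + 1) x) *
          (ζ ^ (1 / 2 : ℝ) * rcNorm (2 * n + 1) y)) := by
        gcongr
        · exact hroot x
        · exact hroot y
    _ = (ζ ^ (1 / 2 : ℝ)) ^ 2 * bilinNorm n u * rcNorm (2 * n + 1) x * rcNorm (2 * n + 1) y := by
        ring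
    _ = _ := by rw [ennreal_rpow_half_sq]

theorem grothendieckConst_le : grothendieckConst ≤ ENNReal.ofReal (Real.pi ^ 2 / 6) :=
  iSup₂_le fun n _ => sInf_le (grothendieckIneq_pi_sq_div_six n)

/-- The best constant is attained. -/
theorem enorm_sum_le_grothendieckConst {n : ℕ} (hn : 1 ≤ n) {u : Schw →ₗ[ℂ] Schw →ₗ[ℂ] ℂ}
    (hu : ContinuousBilin u) (hB : bilinNorm n u ≠ ∞) {m : ℕ} (x y : Fin m → Schw) :
    ‖∑ j, u (x j) (y j)‖ₑ ≤
      grothendieckConst * bilinNorm n u * rcNorm (2 * n + 1) x * rcNorm (2 * n + 1) y := by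
  have hK : grothendieckConst ≠ ∞ := ne_top_of_le_ne_top ENNReal.ofReal_ne_top grothendieckConst_le
  have hfin : bilinNorm n u * rcNorm (2 * n + 1) x * rcNorm (2 * n + 1) y ≠ ∞ :=
    ENNReal.mul_ne_top (ENNReal.mul_ne_top hB (rcNorm_ne_top x)) (rcNorm_ne_top y)
  rw [mul_assoc, mul_assoc, ← mul_assoc (bilinNorm n u)]
  have hlim : Filter.Tendsto (fun C : ℝ≥0∞ => C * (bilinNorm n u * rcNorm (2 * n + 1) x *
      rcNorm (2 * n + 1) y)) (nhdsWithin grothendieckConst (Set.Ioi grothendieckConst))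
      (nhds (grothendieckConst * (bilinNorm n u * rcNorm (2 * n + 1) x *
        rcNorm (2 * n + 1) y))) :=
    ((ENNReal.continuous_mul_const hfin).tendsto _).mono_left nhdsWithin_le_nhds
  have : (nhdsWithin grothendieckConst (Set.Ioi grothendieckConst)).NeBot :=
    nhdsGT_neBot_of_exists_gt ⟨∞, hK.lt_top⟩
  -- Each C > K exceeds some admissible constant for n; finiteness of the other factors allows C to
  -- decrease to K.
  refine ge_of_tendsto hlim (Filter.eventually_of_mem self_mem_nhdsWithin fun C hC => ?_)
  have h1 : bestConst n < C :=
    (le_iSup₂ (f := fun n (_ : 1 ≤ n) => bestConst n) n hn).trans_lt hC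
  obtain ⟨C', hC', hlt⟩ := sInf_lt_iff.1 h1
  refine (hC' u hu m x y).trans ?_
  rw [mul_assoc, mul_assoc, ← mul_assoc (bilinNorm n u)]
  gcongr

end NCSchwartz

/-! ### Separation and optimization lemmas -/

/-- A finite-dimensional separation argument: a family of continuous affine functions on a compact
convex set has a common point of nonnegativity as soon as each of its nonnegative combinations is
nonnegative somewhere. -/
theorem IsCompact.exists_forall_nonneg_of_affine {E ι : Type*} [AddCommGroup E] [Module ℝ E]
    [TopologicalSpace E] {S : Set E} (hS : IsCompact S) (hconv : Convex ℝ S) (f : ι → E → ℝ)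
    (hf : ∀ i, Continuous (f i))
    (haff : ∀ i p q (a b : ℝ), a + b = 1 → f i (a • p + b • q) = a * f i p + b * f i q)
    (h : ∀ (s : Finset ι) (c : s → ℝ), (∀ i, 0 ≤ c i) → ∃ p ∈ S, 0 ≤ ∑ i, c i * f i p) :
    ∃ p ∈ S, ∀ i, 0 ≤ f i p := by
  classical
  obtain ⟨p, hp, hp2⟩ := hS.inter_iInter_nonempty (fun i => {p | 0 ≤ f i p})
    (fun i => isClosed_le continuous_const (hf i)) fun s => by
      let F : E → s → ℝ := fun p i => f i p
      have hF : Continuous F := continuous_pi fun i => hf i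
      have himg : Convex ℝ (F '' S) := by
        rintro _ ⟨p, hp, rfl⟩ _ ⟨q, hq, rfl⟩ a b ha hb hab
        exact ⟨a • p + b • q, hconv hp hq ha hb hab, funext fun i => haff i p q a b hab⟩
      by_contra hne
      -- By compactness only finitely many functions matter. If they had no common point of
      -- nonnegativity, their joint image, compact and convex, would miss the closed orthant.
      have hdisj : Disjoint (F '' S) (Set.Ici (0 : s → ℝ)) := by
        rw [Set.disjoint_left]
        rintro _ ⟨p, hp, rfl⟩ h0
        refine hne ⟨p, hp, ?_⟩
        simp only [Set.mem_iInter, Set.mem_ofPred_eq]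
        exact fun i hi => h0 ⟨i, hi⟩
      obtain ⟨l, u, v, hu, huv, hv⟩ := geometric_hahn_banach_compact_closed himg
        (hS.image hF) (convex_Ici 0) isClosed_Ici hdisj
      have hv0 : v < 0 := by simpa using hv 0 (Set.mem_Ici.2 le_rfl)
      have hl : ∀ w : s → ℝ, l w = ∑ i, l (Pi.single i 1) * w i := fun w => by
        conv_lhs => rw [pi_eq_sum_univ' w, map_sum]
        refine Finset.sum_congr rfl fun i _ => ?_
        rw [map_smul, smul_eq_mul, mul_comm]
      have hc : ∀ i : s, 0 ≤ l (Pi.single i 1) := fun i => by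
        by_contra hneg
        push Not at hneg
        -- A negative coefficient is impossible: since v < 0, this multiple of the basis vector lies
        -- in the orthant, yet `l` takes the value v on it instead of exceeding v.
        have h1 := hv ((v / l (Pi.single i 1)) • Pi.single i 1) (by
          rw [Set.mem_Ici]
          refine smul_nonneg (div_nonneg_of_nonpos hv0.le hneg.le) ?_
          exact Pi.single_nonneg.2 zero_le_one)
        rw [map_smul, smul_eq_mul, div_mul_cancel₀ _ hneg.ne] at h1
        exact lt_irrefl _ h1
      obtain ⟨p, hp, hp0⟩ := h s _ hc
      have h2 := hu (F p) ⟨p, hp, rfl⟩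
      rw [hl] at h2
      exact absurd (hp0.trans_lt (h2.trans (huv.trans hv0))) (lt_irrefl _)
  exact ⟨p, hp, fun i => Set.mem_iInter.1 hp2 i⟩

/-- The bracket is smallest at t² = √Q/√P, where it equals 2√P√Q. Replacing P, Q by P+ε, Q+ε keeps
this choice meaningful when one of them vanishes; then ε → 0. -/
theorem le_mul_sqrt_mul_sqrt_of_forall {A c P Q : ℝ} (hA : 0 ≤ A) (hP : 0 ≤ P) (hQ : 0 ≤ Q)
    (h : ∀ t : ℝ, 0 < t → 2 * c ≤ A * (t ^ 2 * P + (t⁻¹) ^ 2 * Q)) : c ≤ A * √P * √Q := by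
  have key : ∀ ε : ℝ, 0 < ε → c ≤ A * √(P + ε) * √(Q + ε) := fun ε hε => by
    have hp : 0 < √(P + ε) := Real.sqrt_pos.2 (by linarith)
    have hq : 0 < √(Q + ε) := Real.sqrt_pos.2 (by linarith)
    have h1 := h √(√(Q + ε) / √(P + ε)) (by positivity)
    rw [inv_pow, Real.sq_sqrt (by positivity)] at h1
    have h2 : √(Q + ε) / √(P + ε) * P + (√(Q + ε) / √(P + ε))⁻¹ * Q ≤
        2 * (√(P + ε) * √(Q + ε)) := by
      have e1 : √(Q + ε) / √(P + ε) * P ≤ √(Q + ε) / √(P + ε) * √(P + ε) ^ 2 := by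
        gcongr; rw [Real.sq_sqrt (by linarith)]; linarith
      have e2 : (√(Q + ε) / √(P + ε))⁻¹ * Q ≤ (√(Q + ε) / √(P + ε))⁻¹ * √(Q + ε) ^ 2 := by
        gcongr; rw [Real.sq_sqrt (by linarith)]; linarith
      refine (add_le_add e1 e2).trans_eq ?_
      field_simp
      ring
    have h3 := mul_le_mul_of_nonneg_left h2 hA
    linarith
  have hlim : Filter.Tendsto (fun ε : ℝ => A * √(P + ε) * √(Q + ε))
      (nhdsWithin 0 (Set.Ioi 0)) (nhds (A * √(P + 0) * √(Q + 0))) :=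
    (Continuous.tendsto (by fun_prop) 0).mono_left nhdsWithin_le_nhds
  rw [add_zero, add_zero] at hlim
  exact ge_of_tendsto hlim (Filter.eventually_of_mem self_mem_nhdsWithin key)

namespace NCSchwartz

/-! ### States -/

theorem opNorm_le_one_mem_nhds (k : ℕ) : {x : Schw | opNorm k x ≤ 1} ∈ nhds (0 : Schw) := by
  have hV : {ξ : Rapid | rapidNorm k ξ < 1} ∈ nhds (0 : Rapid) := by
    have := (rapid_withSeminorms.continuous_seminorm k).continuousAt.eventually_lt
      (continuousAt_const (x := (0 : Rapid)) (y := (1 : ℝ))) (by simp)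
    exact this
  refine Filter.mem_of_superset (ContinuousLinearMap.hasBasis_nhds_zero.mem_of_mem
    (i := (polarBall k, {ξ : Rapid | rapidNorm k ξ < 1})) ⟨isVonNBounded_polarBall k, hV⟩) ?_
  intro x hx
  exact opNorm_le fun ξ hξ => by
    rw [← ENNReal.ofReal_one]; exact ENNReal.ofReal_le_ofReal (hx ξ hξ).le

/-- Ensures that a pointwise limit of functionals dominated by ‖·‖_k stays in the dual, as the
compactness proof requires. -/
theorem continuous_of_norm_le_opNorm (k : ℕ) (f : Schw →ₗ[ℂ] ℂ)
    (h : ∀ x, ‖f x‖ ≤ (opNorm k x).toReal) : Continuous f := by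
  have hp : Continuous ((normSeminorm ℂ ℂ).comp f) := by
    refine Seminorm.continuous' (r := 1) (Filter.mem_of_superset (opNorm_le_one_mem_nhds k) ?_)
    intro x hx
    rw [Seminorm.mem_closedBall_zero]
    exact (h x).trans (ENNReal.toReal_mono ENNReal.one_ne_top hx)
  refine continuous_of_continuousAt_zero f ?_
  rw [ContinuousAt, map_zero, tendsto_zero_iff_norm_tendsto_zero]
  have := hp.tendsto 0
  rw [map_zero] at this
  exact this

/-- Banach–Alaoglu: in the space of all functions on `Schw` the image is a product of discs cut by
the closed conditions of linearity, and domination by ‖·‖_k makes each such function continuous. -/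
theorem isCompact_setOf_norm_le_opNorm (k : ℕ) :
    IsCompact {φ : WeakDual ℂ Schw | ∀ x, ‖φ x‖ ≤ (opNorm k x).toReal} := by
  have hemb : Topology.IsEmbedding fun (φ : WeakDual ℂ Schw) (x : Schw) => φ x :=
    WeakBilin.isEmbedding ContinuousLinearMap.coe_injective
  rw [hemb.isCompact_iff]
  have himg : (fun (φ : WeakDual ℂ Schw) (x : Schw) => φ x) ''
      {φ : WeakDual ℂ Schw | ∀ x, ‖φ x‖ ≤ (opNorm k x).toReal} =
      (Set.univ.pi fun x : Schw => Metric.closedBall (0 : ℂ) (opNorm k x).toReal) ∩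
      {f | (∀ x y, f (x + y) = f x + f y) ∧ ∀ (c : ℂ) x, f (c • x) = c • f x} := by
    ext f
    constructor
    · rintro ⟨φ, hφ, rfl⟩
      exact ⟨fun x _ => by simpa using hφ x, fun x y => map_add φ x y, fun c x => map_smul φ c x⟩
    · rintro ⟨h1, h2, h3⟩
      have h1' : ∀ x, ‖f x‖ ≤ (opNorm k x).toReal := fun x => by simpa using h1 x (Set.mem_univ x)
      let g : Schw →ₗ[ℂ] ℂ := { toFun := f, map_add' := h2, map_smul' := h3 }
      exact ⟨StrongDual.toWeakDual ⟨g, continuous_of_norm_le_opNorm k g h1'⟩, h1', rfl⟩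
  rw [himg]
  refine (isCompact_univ_pi fun x => isCompact_closedBall _ _).inter_right ?_
  simp only [Set.ofPred_and, Set.ofPred_forall]
  refine IsClosed.inter ?_ ?_
  · exact isClosed_iInter fun x => isClosed_iInter fun y => isClosed_eq (by fun_prop) (by fun_prop)
  · exact isClosed_iInter fun c => isClosed_iInter fun x => isClosed_eq (by fun_prop) (by fun_prop)

/-- Any closed convex condition on states needs checking on vector functionals only. -/
theorem nStates_subset {k : ℕ} {C : Set (WeakDual ℂ Schw)} (hc : IsClosed C) (hconv : Convex ℝ C)
    (h : ∀ ξ ∈ polarBall k, vecFunctional ξ ∈ C) : nStates k ⊆ C :=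
  closure_minimal (convexHull_min (Set.image_subset_iff.2 h) hconv) hc

theorem vecFunctional_mem_nStates {k : ℕ} {ξ : Slow} (hξ : ξ ∈ polarBall k) :
    vecFunctional ξ ∈ nStates k :=
  subset_closure (subset_convexHull ℝ _ ⟨ξ, hξ, rfl⟩)

theorem convex_nStates (k : ℕ) : Convex ℝ (nStates k) := (convex_convexHull ℝ _).closure

theorem isCompact_nStates (k : ℕ) : IsCompact (nStates k) := by
  refine (isCompact_setOf_norm_le_opNorm k).of_isClosed_subset isClosed_closure
    (nStates_subset ?_ ?_ ?_)
  · simp only [Set.ofPred_forall]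
    exact isClosed_iInter fun x => isClosed_le (WeakDual.eval_continuous x).norm continuous_const
  · intro φ hφ ψ hψ a b ha hb hab x
    calc ‖(a • φ + b • ψ) x‖ = ‖a • φ x + b • ψ x‖ := rfl
      _ ≤ a * ‖φ x‖ + b * ‖ψ x‖ := by
        refine (norm_add_le _ _).trans_eq ?_
        rw [norm_smul, norm_smul, Real.norm_of_nonneg ha, Real.norm_of_nonneg hb]
      _ ≤ a * (opNorm k x).toReal + b * (opNorm k x).toReal := by
        gcongr
        · exact hφ x
        · exact hψ x
      _ = (opNorm k x).toReal := by rw [← add_mul, hab, one_mul]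
  · intro ξ hξ x
    refine (norm_pairing_le ((x ξ).wsummable k) hξ.1).trans ?_
    exact (mul_le_of_le_one_right (wNorm_nonneg _ _) hξ.2).trans (wNorm_le_toReal_opNorm x hξ)

theorem re_add_smul_apply (φ ψ : WeakDual ℂ Schw) (a b : ℝ) (x : Schw) :
    ((a • φ + b • ψ) x).re = a * (φ x).re + b * (ψ x).re := by
  have : (a • φ + b • ψ) x = a • φ x + b • ψ x := rfl
  rw [this, Complex.add_re, Complex.smul_re, Complex.smul_re, smul_eq_mul, smul_eq_mul]

theorem continuous_re_apply (x : Schw) : Continuous fun φ : WeakDual ℂ Schw => (φ x).re :=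
  Complex.continuous_re.comp (WeakDual.eval_continuous x)

theorem re_vecFunctional_star_mul (x : Schw) (ξ : Slow) :
    (vecFunctional ξ (star x * x)).re = wNorm 0 (x ξ).seq ^ 2 := by
  rw [vecFunctional_star_mul, Complex.ofReal_re]

theorem nStates_star_mul_nonneg {k : ℕ} {φ : WeakDual ℂ Schw} (hφ : φ ∈ nStates k) (x : Schw) :
    0 ≤ (φ (star x * x)).re := by
  refine nStates_subset (C := {φ | 0 ≤ (φ (star x * x)).re})
    (isClosed_le continuous_const (continuous_re_apply _)) ?_ ?_ hφ
  · intro φ hφ ψ hψ a b ha hb _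
    rw [Set.mem_ofPred_eq, re_add_smul_apply]
    exact add_nonneg (mul_nonneg ha hφ) (mul_nonneg hb hψ)
  · intro ξ _
    rw [Set.mem_ofPred_eq, re_vecFunctional_star_mul]
    positivity

theorem nStates_mul_star_nonneg {k : ℕ} {φ : WeakDual ℂ Schw} (hφ : φ ∈ nStates k) (x : Schw) :
    0 ≤ (φ (x * star x)).re := by
  have h := nStates_star_mul_nonneg hφ (star x)
  rwa [star_star_schw] at h

/-- The norm `|·|_k` is dual to `|·|'_k`. -/
theorem exists_polarBall_pairing_eq (k : ℕ) (ζ : Rapid) :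
    ∃ η ∈ polarBall k, pairing ζ.seq η.seq = wNorm k ζ.seq := by
  rcases (wNorm_nonneg k ζ.seq).eq_or_lt with h0 | hpos
  · exact ⟨0, zero_mem_polarBall k, by simp [← h0, Slow.seq_zero, pairing]⟩
  set N := wNorm k ζ.seq with hN
  -- The equality case of Cauchy–Schwarz: g_j = j^{2k} ζ_j, to be divided by its dual norm N.
  let g : ℕ+ → ℂ := fun j => (((j : ℝ) ^ (2 * (k : ℤ)) : ℝ) : ℂ) * ζ.seq j
  have hg : ∀ j, ‖g j‖ ^ 2 * (j : ℝ) ^ (2 * (-k : ℤ)) =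
      ‖ζ.seq j‖ ^ 2 * (j : ℝ) ^ (2 * (k : ℤ)) := fun j => by
    have hj := pos_cast j
    have hz : (0 : ℝ) < (j : ℝ) ^ (2 * (k : ℤ)) := zpow_pos hj _
    simp only [g]
    rw [norm_mul, Complex.norm_real, Real.norm_of_nonneg hz.le, mul_neg, zpow_neg]
    field_simp
  have hgs : WSummable (-k) g := (ζ.wsummable k).congr fun j => (hg j).symm
  have hgn : wNorm (-k) g = N := by rw [hN, wNorm, wNorm, tsum_congr hg]
  let η₀ : Slow := (⟨g, k, hgs⟩ : slowSubmodule)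
  have hη₀ : η₀.seq = g := rfl
  have hp : pairing ζ.seq g = ((N ^ 2 : ℝ) : ℂ) := by
    rw [hN, wNorm_sq, Complex.ofReal_tsum, pairing]
    refine tsum_congr fun j => ?_
    simp only [g]
    rw [map_mul, Complex.conj_ofReal, mul_left_comm, Complex.mul_conj, Complex.normSq_eq_norm_sq,
      ← Complex.ofReal_mul, mul_comm]
  refine ⟨((N⁻¹ : ℝ) : ℂ) • η₀, ⟨hgs.smul _, ?_⟩, ?_⟩
  · rw [Slow.seq_smul, wNorm_smul, hη₀, hgn, Complex.norm_real,
      Real.norm_of_nonneg (inv_nonneg.2 hpos.le), inv_mul_cancel₀ hpos.ne']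
  · rw [← pairing_conj, Slow.seq_smul, pairing_smul_left, map_mul, Complex.conj_ofReal, hη₀,
      pairing_conj, hp, ← Complex.ofReal_mul]
    congr 1
    field_simp

/-- The norm of a sum of squares is dominated by its value at some state. -/
theorem exists_nStates_opNorm_le (k : ℕ) {m : ℕ} (x : Fin m → Schw) :
    ∃ φ ∈ nStates k, (opNorm k (∑ j, star (x j) * x j)).toReal ≤
      ∑ j, (φ (star (x j) * x j)).re := by
  have hsum : ∀ φ : WeakDual ℂ Schw,
      (φ (∑ j, star (x j) * x j)).re = ∑ j, (φ (star (x j) * x j)).re := fun φ => by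
    rw [map_sum, Complex.re_sum]
  -- A state maximizing φ(T), T = ∑ x_j* x_j. For suitable η in the polar, |Tξ|_k = ⟨Tξ, η⟩ ≤ ½(⟨Tξ,
  -- ξ⟩ + ⟨Tη, η⟩), and both terms are values of vector functionals at T.
  obtain ⟨φ, hφ, hmax⟩ := (isCompact_nStates k).exists_isMaxOn
    ⟨_, vecFunctional_mem_nStates (zero_mem_polarBall k)⟩
    (continuous_re_apply (∑ j, star (x j) * x j)).continuousOn
  refine ⟨φ, hφ, ?_⟩
  rw [← hsum]
  have hvec : ∀ ξ ∈ polarBall k, ∑ j, wNorm 0 (x j ξ).seq ^ 2 ≤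
      (φ (∑ j, star (x j) * x j)).re := fun ξ hξ => by
    have h := hmax (vecFunctional_mem_nStates hξ)
    simp only [Set.mem_ofPred_eq] at h
    rw [hsum (vecFunctional ξ)] at h
    simpa only [re_vecFunctional_star_mul] using h
  have h0 : 0 ≤ (φ (∑ j, star (x j) * x j)).re :=
    (Finset.sum_nonneg fun j _ => sq_nonneg _).trans (hvec 0 (zero_mem_polarBall k))
  refine ENNReal.toReal_le_of_le_ofReal h0 (opNorm_le fun ξ hξ => ENNReal.ofReal_le_ofReal ?_)
  obtain ⟨η, hη, heq⟩ := exists_polarBall_pairing_eq k ((∑ j, star (x j) * x j) ξ)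
  have h1 : wNorm k ((∑ j, star (x j) * x j) ξ).seq ≤
      ∑ j, wNorm 0 (x j ξ).seq * wNorm 0 (x j η).seq := by
    rw [← Real.norm_of_nonneg (wNorm_nonneg k _), ← Complex.norm_real, ← heq,
      pairing_sum_star_mul]
    exact (norm_sum_le _ _).trans (Finset.sum_le_sum fun j _ => norm_pairing_zero_le _ _)
  have h2 : 2 * ∑ j, wNorm 0 (x j ξ).seq * wNorm 0 (x j η).seq ≤
      ∑ j, wNorm 0 (x j ξ).seq ^ 2 + ∑ j, wNorm 0 (x j η).seq ^ 2 := by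
    rw [Finset.mul_sum, ← Finset.sum_add_distrib]
    exact Finset.sum_le_sum fun j _ => by
      rw [← mul_assoc]; exact two_mul_le_add_sq _ _
  linarith [hvec ξ hξ, hvec η hη]

/-! ### A faithful state -/

/-- The state is ∑_{j<N} 2^{-(j+1)} φ_{e_j} plus a multiple of φ_0 = 0; the induction averages
φ_{e_0} with the state for the shifted sequence. -/
theorem exists_nStates_dominating (k : ℕ) (N : ℕ) (e : ℕ → Slow) (he : ∀ j, e j ∈ polarBall k) :
    ∃ φ ∈ nStates k, ∀ x : Schw, ∀ j < N,
      (1 / 2 : ℝ) ^ (j + 1) * wNorm 0 (x (e j)).seq ^ 2 ≤ (φ (star x * x)).re := by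
  induction N generalizing e with
  | zero =>
    exact ⟨_, vecFunctional_mem_nStates (zero_mem_polarBall k), fun x j hj =>
      absurd hj (Nat.not_lt_zero j)⟩
  | succ N ih =>
    obtain ⟨φ, hφ, h⟩ := ih (fun j => e (j + 1)) fun j => he _
    refine ⟨(1 / 2 : ℝ) • vecFunctional (e 0) + (1 / 2 : ℝ) • φ,
      convex_nStates k (vecFunctional_mem_nStates (he 0)) hφ (by norm_num) (by norm_num)
        (by norm_num), fun x j hj => ?_⟩
    rw [re_add_smul_apply, re_vecFunctional_star_mul]
    have h0 := nStates_star_mul_nonneg hφ x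
    have h1 := sq_nonneg (wNorm 0 (x (e 0)).seq)
    rcases j with _ | j
    · rw [zero_add, pow_one]; linarith
    · have h2 := h x j (by omega)
      rw [pow_succ]; linarith

theorem exists_faithful_nStates (k : ℕ) :
    ∃ φ ∈ nStates k, ∀ x : Schw, x ≠ 0 → 0 < (φ (star x * x)).re := by
  let e : ℕ → Slow := fun j => unitVec j.succPNat
  let C : ℕ → Set (WeakDual ℂ Schw) := fun j =>
    {φ | ∀ x : Schw, (1 / 2 : ℝ) ^ (j + 1) * wNorm 0 (x (e j)).seq ^ 2 ≤ (φ (star x * x)).re}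
  have hclosed : ∀ j, IsClosed (C j) := fun j => by
    simp only [C, Set.ofPred_forall]
    exact isClosed_iInter fun x => isClosed_le continuous_const (continuous_re_apply _)
  -- Compactness replaces the convergence of ∑ 2^{-(j+1)} φ_{e_j}: the finite stages show that the
  -- closed sets `C j` have the finite intersection property.
  obtain ⟨φ, hφ, hC⟩ := (isCompact_nStates k).inter_iInter_nonempty C hclosed fun s => by
    obtain ⟨φ, hφ, h⟩ := exists_nStates_dominating k (s.sup id + 1) e
      fun j => unitVec_mem_polarBall k _
    refine ⟨φ, hφ, ?_⟩
    simp only [Set.mem_iInter]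
    exact fun j hj x => h x j (Nat.lt_succ_of_le (Finset.le_sup (f := id) hj))
  refine ⟨φ, hφ, fun x hx => ?_⟩
  obtain ⟨i, a, ha⟩ := exists_entry_ne_zero hx
  have hpos : 0 < wNorm 0 (x (e i.natPred)).seq := by
    have h := norm_entry_le_wNorm 0 (x (unitVec i)) a
    simp only [e, PNat.succPNat_natPred]
    exact (norm_pos_iff.2 ha).trans_le h
  exact lt_of_lt_of_le (by positivity) (Set.mem_iInter.1 hC i.natPred x)

/-! ### The Grothendieck constant is positive -/

/-- The test form is u(x, y) = x_ji y_ji for a nonzero entry of the given element: its norm at n = 1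
is at most 1, while u(x, x) = x_ji² ≠ 0. -/
theorem grothendieckConst_ne_zero {x : Schw} (hx : x ≠ 0) : grothendieckConst ≠ 0 := by
  obtain ⟨i, j, hij⟩ := exists_entry_ne_zero hx
  let f : Schw →ₗ[ℂ] ℂ :=
    { toFun := fun x => pairing (x (unitVec i)).seq (unitVec j).seq
      map_add' := fun x y => pairing_add_left (x (unitVec i)) (y (unitVec i)) (unitVec j)
      map_smul' := fun c x => pairing_smul_left c (x (unitVec i)).seq (unitVec j).seq }
  have hf : ∀ x, f x = (x (unitVec i)).seq j := fun x => pairing_unitVec _ j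
  have hfc : Continuous f :=
    (continuous_pairing (unitVec j)).comp (continuous_eval_const (unitVec i))
  have hfn : ∀ x, ‖f x‖ₑ ≤ opNorm 1 x := fun x => by
    rw [hf, ← ofReal_norm]
    exact (ENNReal.ofReal_le_ofReal (norm_entry_le_wNorm 1 _ j)).trans
      (ofReal_le_opNorm x (unitVec_mem_polarBall 1 i))
  let u : Schw →ₗ[ℂ] Schw →ₗ[ℂ] ℂ := (LinearMap.mul ℂ ℂ).compl₁₂ f f
  have hu : ∀ x y, u x y = f x * f y := fun _ _ => rfl
  have hcont : ContinuousBilin u := by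
    simp only [ContinuousBilin, hu]
    exact (hfc.comp continuous_fst).mul (hfc.comp continuous_snd)
  have hB : bilinNorm 1 u ≤ 1 := by
    refine iSup_le fun x => iSup_le fun y => iSup_le fun h1 => iSup_le fun h2 => ?_
    rw [hu, enorm_mul]
    exact mul_le_one' ((hfn x).trans h1) ((hfn y).trans h2)
  intro hK
  have h := enorm_sum_le_grothendieckConst le_rfl hcont
    (ne_top_of_le_ne_top ENNReal.one_ne_top hB) (fun _ : Fin 1 => x) fun _ => x
  rw [hK, zero_mul, zero_mul, zero_mul, Fin.sum_univ_one, hu, nonpos_iff_eq_zero, enorm_eq_zero,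
    mul_self_eq_zero, hf] at h
  exact hij h

/-! ### Factorization through states -/

theorem norm_sum_le_grothendieckConst {n : ℕ} (hn : 1 ≤ n) {u : Schw →ₗ[ℂ] Schw →ₗ[ℂ] ℂ}
    (hu : ContinuousBilin u) (hB : bilinNorm n u ≠ ∞) {m : ℕ} (x y : Fin m → Schw) :
    ‖∑ j, u (x j) (y j)‖ ≤ (grothendieckConst * bilinNorm n u).toReal *
      (rcNorm (2 * n + 1) x).toReal * (rcNorm (2 * n + 1) y).toReal := by
  have hK : grothendieckConst ≠ ∞ := ne_top_of_le_ne_top ENNReal.ofReal_ne_top grothendieckConst_le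
  rw [← ENNReal.toReal_mul, ← ENNReal.toReal_mul, ← toReal_enorm]
  refine ENNReal.toReal_mono ?_ (enorm_sum_le_grothendieckConst hn hu hB x y)
  exact ENNReal.mul_ne_top (ENNReal.mul_ne_top (ENNReal.mul_ne_top hK hB) (rcNorm_ne_top x))
    (rcNorm_ne_top y)

theorem exists_nStates_rcNorm_sq_le (k : ℕ) {m : ℕ} (x : Fin m → Schw) :
    ∃ φ₁ ∈ nStates k, ∃ φ₂ ∈ nStates k, (rcNorm k x).toReal ^ 2 ≤
      ∑ j, ((φ₁ (star (x j) * x j)).re + (φ₂ (x j * star (x j))).re) := by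
  obtain ⟨φ₁, hφ₁, h1⟩ := exists_nStates_opNorm_le k x
  obtain ⟨φ₂, hφ₂, h2⟩ := exists_nStates_opNorm_le k fun j => star (x j)
  simp only [star_star_schw] at h2
  refine ⟨φ₁, hφ₁, φ₂, hφ₂, ?_⟩
  rw [← ENNReal.toReal_pow, rcNorm_sq, ENNReal.toReal_max (opNorm_ne_top _ _) (opNorm_ne_top _ _),
    Finset.sum_add_distrib]
  exact (max_le_add_of_nonneg ENNReal.toReal_nonneg ENNReal.toReal_nonneg).trans (add_le_add h1 h2)

theorem star_smul_mul_smul (c : ℂ) (x : Schw) :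
    star (c • x) * (c • x) = ((‖c‖ ^ 2 : ℝ) : ℂ) • (star x * x) := by
  rw [star_smul_schw, smul_mul_smul_schw, Complex.conj_mul']
  push_cast
  rfl

theorem smul_mul_star_smul (c : ℂ) (x : Schw) :
    (c • x) * star (c • x) = ((‖c‖ ^ 2 : ℝ) : ℂ) • (x * star x) := by
  rw [star_smul_schw, smul_mul_smul_schw, Complex.mul_conj']
  push_cast
  rfl

/-- The quadratic form `x ↦ φ₁(x* x) + φ₂(x x*)`. -/
noncomputable def stateForm (φ₁ φ₂ : WeakDual ℂ Schw) (x : Schw) : ℝ :=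
  (φ₁ (star x * x)).re + (φ₂ (x * star x)).re

theorem stateForm_smul (φ₁ φ₂ : WeakDual ℂ Schw) (c : ℂ) (x : Schw) :
    stateForm φ₁ φ₂ (c • x) = ‖c‖ ^ 2 * stateForm φ₁ φ₂ x := by
  rw [stateForm, stateForm, star_smul_mul_smul, smul_mul_star_smul, map_smul, map_smul,
    smul_eq_mul, smul_eq_mul, Complex.re_ofReal_mul, Complex.re_ofReal_mul, mul_add]

theorem stateForm_add_smul (φ₁ φ₂ ψ₁ ψ₂ : WeakDual ℂ Schw) (a b : ℝ) (x : Schw) :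
    stateForm (a • φ₁ + b • ψ₁) (a • φ₂ + b • ψ₂) x =
      a * stateForm φ₁ φ₂ x + b * stateForm ψ₁ ψ₂ x := by
  simp only [stateForm, re_add_smul_apply]
  ring

theorem stateForm_nonneg {k : ℕ} {φ₁ φ₂ : WeakDual ℂ Schw} (h₁ : φ₁ ∈ nStates k)
    (h₂ : φ₂ ∈ nStates k) (x : Schw) : 0 ≤ stateForm φ₁ φ₂ x :=
  add_nonneg (nStates_star_mul_nonneg h₁ x) (nStates_mul_star_nonneg h₂ x)

/-- The weights are absorbed as √c_j in each argument and the phase of u(x_j, y_j) in the first, so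
no cancellation occurs in the sum. Phases leave `stateForm` unchanged, and 2ab ≤ a² + b² makes the
bound affine in the states. -/
theorem exists_nStates_weighted_sum_le {n : ℕ} (hn : 1 ≤ n) {u : Schw →ₗ[ℂ] Schw →ₗ[ℂ] ℂ}
    (hu : ContinuousBilin u) (hB : bilinNorm n u ≠ ∞) {m : ℕ} (x y : Fin m → Schw)
    (c : Fin m → ℝ) (hc : ∀ j, 0 ≤ c j) :
    ∃ φ₁ ∈ nStates (2 * n + 1), ∃ φ₂ ∈ nStates (2 * n + 1),
    ∃ ψ₁ ∈ nStates (2 * n + 1), ∃ ψ₂ ∈ nStates (2 * n + 1),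
      2 * ∑ j, c j * ‖u (x j) (y j)‖ ≤ (grothendieckConst * bilinNorm n u).toReal *
        ∑ j, c j * (stateForm φ₁ φ₂ (x j) + stateForm ψ₁ ψ₂ (y j)) := by
  choose θ hθ hθu using fun j => Complex.exists_norm_eq_mul_self (u (x j) (y j))
  let x' : Fin m → Schw := fun j => ((√(c j) : ℂ) * θ j) • x j
  let y' : Fin m → Schw := fun j => (√(c j) : ℂ) • y j
  have hsq : ∀ j, ‖(√(c j) : ℂ)‖ ^ 2 = c j := fun j => by
    rw [Complex.norm_real, Real.norm_of_nonneg (Real.sqrt_nonneg _), Real.sq_sqrt (hc j)]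
  have hu' : ∀ j, u (x' j) (y' j) = ((c j * ‖u (x j) (y j)‖ : ℝ) : ℂ) := fun j => by
    have h : (√(c j) : ℂ) * √(c j) = c j := by
      rw [← Complex.ofReal_mul, Real.mul_self_sqrt (hc j)]
    simp only [x', y']
    rw [map_smul, map_smul, LinearMap.smul_apply, smul_eq_mul, smul_eq_mul, Complex.ofReal_mul,
      hθu, ← h]
    ring
  have hsum : ‖∑ j, u (x' j) (y' j)‖ = ∑ j, c j * ‖u (x j) (y j)‖ := by
    simp only [hu']
    rw [← Complex.ofReal_sum, Complex.norm_real, Real.norm_of_nonneg]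
    exact Finset.sum_nonneg fun j _ => mul_nonneg (hc j) (norm_nonneg _)
  obtain ⟨φ₁, h1, φ₂, h2, hx⟩ := exists_nStates_rcNorm_sq_le (2 * n + 1) x'
  obtain ⟨ψ₁, h3, ψ₂, h4, hy⟩ := exists_nStates_rcNorm_sq_le (2 * n + 1) y'
  refine ⟨φ₁, h1, φ₂, h2, ψ₁, h3, ψ₂, h4, ?_⟩
  set A := (grothendieckConst * bilinNorm n u).toReal
  have hx' : ∑ j, stateForm φ₁ φ₂ (x' j) = ∑ j, c j * stateForm φ₁ φ₂ (x j) :=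
    Finset.sum_congr rfl fun j _ => by
      rw [stateForm_smul, norm_mul, hθ, mul_one, hsq]
  have hy' : ∑ j, stateForm ψ₁ ψ₂ (y' j) = ∑ j, c j * stateForm ψ₁ ψ₂ (y j) :=
    Finset.sum_congr rfl fun j _ => by rw [stateForm_smul, hsq]
  have hG := norm_sum_le_grothendieckConst hn hu hB x' y'
  rw [hsum, mul_assoc] at hG
  calc 2 * ∑ j, c j * ‖u (x j) (y j)‖
      ≤ A * (2 * (rcNorm (2 * n + 1) x').toReal * (rcNorm (2 * n + 1) y').toReal) := by
        linarith
    _ ≤ A * ((rcNorm (2 * n + 1) x').toReal ^ 2 + (rcNorm (2 * n + 1) y').toReal ^ 2) := by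
        gcongr
        exact two_mul_le_add_sq _ _
    _ ≤ A * (∑ j, stateForm φ₁ φ₂ (x' j) + ∑ j, stateForm ψ₁ ψ₂ (y' j)) := by
        gcongr
        · exact hx
        · exact hy
    _ = _ := by
        rw [hx', hy', ← Finset.sum_add_distrib]
        simp only [mul_add]

theorem exists_nStates_two_mul_norm_le {n : ℕ} (hn : 1 ≤ n) {u : Schw →ₗ[ℂ] Schw →ₗ[ℂ] ℂ}
    (hu : ContinuousBilin u) (hB : bilinNorm n u ≠ ∞) :
    ∃ φ₁ ∈ nStates (2 * n + 1), ∃ φ₂ ∈ nStates (2 * n + 1),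
    ∃ ψ₁ ∈ nStates (2 * n + 1), ∃ ψ₂ ∈ nStates (2 * n + 1), ∀ x y : Schw,
      2 * ‖u x y‖ ≤ (grothendieckConst * bilinNorm n u).toReal *
        (stateForm φ₁ φ₂ x + stateForm ψ₁ ψ₂ y) := by
  set A := (grothendieckConst * bilinNorm n u).toReal
  set M := nStates (2 * n + 1)
  let f : Schw × Schw →
      (WeakDual ℂ Schw × WeakDual ℂ Schw) × (WeakDual ℂ Schw × WeakDual ℂ Schw) → ℝ := fun z Φ =>
    A * (stateForm Φ.1.1 Φ.1.2 z.1 + stateForm Φ.2.1 Φ.2.2 z.2) - 2 * ‖u z.1 z.2‖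
  have hM : IsCompact M := isCompact_nStates _
  have hMc : Convex ℝ M := convex_nStates _
  -- The separation lemma on quadruples of states, with one affine function for each pair (x, y).
  obtain ⟨Φ, hΦ, h⟩ := IsCompact.exists_forall_nonneg_of_affine
    (S := (M ×ˢ M) ×ˢ (M ×ˢ M)) ((hM.prod hM).prod (hM.prod hM))
    ((hMc.prod hMc).prod (hMc.prod hMc)) f
    (fun z => by
      have hs := fun x : Schw => continuous_re_apply (star x * x)
      have ht := fun x : Schw => continuous_re_apply (x * star x)
      exact (continuous_const.mul
        ((((hs z.1).comp (continuous_fst.comp continuous_fst)).add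
          ((ht z.1).comp (continuous_snd.comp continuous_fst))).add
        (((hs z.2).comp (continuous_fst.comp continuous_snd)).add
          ((ht z.2).comp (continuous_snd.comp continuous_snd))))).sub continuous_const)
    (fun z p q a b hab => by
      have h1 : stateForm (a • p + b • q).1.1 (a • p + b • q).1.2 z.1 = _ :=
        stateForm_add_smul p.1.1 p.1.2 q.1.1 q.1.2 a b z.1
      have h2 : stateForm (a • p + b • q).2.1 (a • p + b • q).2.2 z.2 = _ :=
        stateForm_add_smul p.2.1 p.2.2 q.2.1 q.2.2 a b z.2
      refine (congrArg₂ (fun v w => A * (v + w) - 2 * ‖u z.1 z.2‖) h1 h2).trans ?_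
      simp only [f]
      linear_combination (2 * ‖u z.1 z.2‖) * hab)
    fun s c hc => by
      obtain ⟨φ₁, h1, φ₂, h2, ψ₁, h3, ψ₂, h4, h⟩ := exists_nStates_weighted_sum_le hn hu hB
        (fun j => (s.equivFin.symm j).1.1) (fun j => (s.equivFin.symm j).1.2)
        (fun j => c (s.equivFin.symm j)) fun j => hc _
      refine ⟨((φ₁, φ₂), (ψ₁, ψ₂)), ⟨⟨h1, h2⟩, ⟨h3, h4⟩⟩, ?_⟩
      rw [s.equivFin.symm.sum_comp fun i => c i * ‖u i.1.1 i.1.2‖,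
        s.equivFin.symm.sum_comp fun i =>
          c i * (stateForm φ₁ φ₂ i.1.1 + stateForm ψ₁ ψ₂ i.1.2)] at h
      rw [← sub_nonneg] at h
      refine h.trans_eq ?_
      rw [Finset.mul_sum, Finset.mul_sum, ← Finset.sum_sub_distrib]
      exact Finset.sum_congr rfl fun i _ => by simp only [f]; ring
  exact ⟨_, hΦ.1.1, _, hΦ.1.2, _, hΦ.2.1, _, hΦ.2.2, fun x y => sub_nonneg.1 (h (x, y))⟩

theorem exists_nStates_norm_le {n : ℕ} (hn : 1 ≤ n) {u : Schw →ₗ[ℂ] Schw →ₗ[ℂ] ℂ}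
    (hu : ContinuousBilin u) (hB : bilinNorm n u ≠ ∞) :
    ∃ φ₁ ∈ nStates (2 * n + 1), ∃ φ₂ ∈ nStates (2 * n + 1),
    ∃ ψ₁ ∈ nStates (2 * n + 1), ∃ ψ₂ ∈ nStates (2 * n + 1), ∀ x y : Schw,
      ‖u x y‖ ≤ (grothendieckConst * bilinNorm n u).toReal *
        √(stateForm φ₁ φ₂ x) * √(stateForm ψ₁ ψ₂ y) := by
  obtain ⟨φ₁, h1, φ₂, h2, ψ₁, h3, ψ₂, h4, h⟩ := exists_nStates_two_mul_norm_le hn hu hB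
  refine ⟨φ₁, h1, φ₂, h2, ψ₁, h3, ψ₂, h4, fun x y => ?_⟩
  refine le_mul_sqrt_mul_sqrt_of_forall ENNReal.toReal_nonneg (stateForm_nonneg h1 h2 x)
    (stateForm_nonneg h3 h4 y) fun t ht => ?_
  -- u is invariant under (x, y) ↦ (tx, t⁻¹y), while the two forms scale by t² and t⁻².
  have hs := h ((t : ℂ) • x) ((t : ℂ)⁻¹ • y)
  have htc : (t : ℂ) ≠ 0 := by exact_mod_cast ht.ne'
  rw [map_smul, map_smul, LinearMap.smul_apply, inv_smul_smul₀ htc, stateForm_smul,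
    stateForm_smul, norm_inv, Complex.norm_real, Real.norm_of_nonneg ht.le] at hs
  exact hs

theorem ofReal_rpow_half (P : ℝ) : ENNReal.ofReal P ^ (1 / 2 : ℝ) = ENNReal.ofReal √P := by
  rcases le_total 0 P with h | h
  · rw [ENNReal.ofReal_rpow_of_nonneg h (by norm_num), Real.sqrt_eq_rpow]
  · rw [ENNReal.ofReal_of_nonpos h, Real.sqrt_eq_zero_of_nonpos h]; simp

end NCSchwartz

/-! ### Conclusion, for infinite and finite ‖u‖_n^* -/

theorem mainTheorem5 :
    grothendieckConst ≤ ENNReal.ofReal (Real.pi ^ 2 / 6) ∧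
    ∀ (u : Schw →ₗ[ℂ] Schw →ₗ[ℂ] ℂ), ContinuousBilin u → ∀ n : ℕ, 1 ≤ n →
      ∃ φ₁ ∈ nStates (2 * n + 1), ∃ φ₂ ∈ nStates (2 * n + 1),
      ∃ ψ₁ ∈ nStates (2 * n + 1), ∃ ψ₂ ∈ nStates (2 * n + 1),
        ∀ x y : Schw,
          ‖u x y‖ₑ ≤ grothendieckConst * bilinNorm n u *
            ENNReal.ofReal ((φ₁ (star x * x)).re + (φ₂ (x * star x)).re) ^ (1 / 2 : ℝ) *
            ENNReal.ofReal ((ψ₁ (star y * y)).re + (ψ₂ (y * star y)).re) ^ (1 / 2 : ℝ) := by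
  refine ⟨grothendieckConst_le, fun u hu n hn => ?_⟩
  by_cases hB : bilinNorm n u = ∞
  -- One faithful state in all four places makes every factor nonzero when x and y are nonzero, so
  -- the right side is ∞; if x or y is zero, the left side vanishes.
  · obtain ⟨φ, hφ, hpos⟩ := exists_faithful_nStates (2 * n + 1)
    refine ⟨φ, hφ, φ, hφ, φ, hφ, φ, hφ, fun x y => ?_⟩
    by_cases hx : x = 0
    · simp [hx]
    by_cases hy : y = 0
    · simp [hy]
    have hform : ∀ z : Schw, z ≠ 0 → ENNReal.ofReal ((φ (star z * z)).re +
        (φ (z * star z)).re) ^ (1 / 2 : ℝ) ≠ 0 := fun z hz => by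
      have h := add_pos_of_pos_of_nonneg (hpos z hz) (nStates_mul_star_nonneg hφ z)
      simpa using h
    rw [hB, ENNReal.mul_top (grothendieckConst_ne_zero hx), ENNReal.top_mul (hform x hx),
      ENNReal.top_mul (hform y hy)]
    exact le_top
  · obtain ⟨φ₁, h1, φ₂, h2, ψ₁, h3, ψ₂, h4, h⟩ := exists_nStates_norm_le hn hu hB
    refine ⟨φ₁, h1, φ₂, h2, ψ₁, h3, ψ₂, h4, fun x y => ?_⟩
    have hK : grothendieckConst ≠ ∞ :=
      ne_top_of_le_ne_top ENNReal.ofReal_ne_top grothendieckConst_le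
    rw [ofReal_rpow_half, ofReal_rpow_half, ← ENNReal.ofReal_toReal (ENNReal.mul_ne_top hK hB),
      ← ENNReal.ofReal_mul ENNReal.toReal_nonneg, ← ENNReal.ofReal_mul (by positivity),
      ← ofReal_norm]
    exact ENNReal.ofReal_le_ofReal (h x y)
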